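/- There are absolute constants $c,C>0$ with the following property. Let $n,d\in\mathbb N$, $\lambda,L_2>0$, and consider the regularized empirical risk minimization problem $$\min_{x\in\mathbb R^d}P(x)=\frac1n\sum_{i=1}^n\phi_i(A_i^Tx)+\lambda g(x),$$ where each $\phi_i:\mathbb R\to\mathbb R$ is convex, bounded below and $L_2$-smooth (differentiable with $L_2$-Lipschitz derivative), $g:\mathbb R^d\to\mathbb R$ is strongly convex with modulus $1$, and $A_1,\dots,A_n\in\mathbb R^d$ satisfy $\|A_i\|\le R$. Let $$D(\alpha)=-\frac1n\sum_{i=1}^n\phi_i^*(-\alpha_i)-\lambda g^*\Big(\frac1{\lambda n}A\alpha\Big),\qquad \alpha\in\mathbb R^n,$$ be the dual objective ($A=[A_1,\dots,A_n]$, and ${}^*$ is the Fenchel conjugate), $P^*=\inf P$ and $D^*=\sup D$, and for a dual point $\alpha$ let $x(\alpha)=\nabla g^*\big(\frac1{\lambda n}A\alpha\big)$ be the associated primal point. Put $L_c=\frac{R^2}{\lambda n^2}$ (the coordinate Lipschitz constant of the smooth part of $-D$) and $\mu=\frac1{nL_2}$ (the strong convexity modulus of its separable part), and assume $\mu\le L_c$,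 that is, $\lambda n\le R^2L_2$. Let $\tau\ge1$ be an integer with $\tau\le\sqrt n$. Run AASCD on $-D=f+\sum_ih_i$, with $f(\alpha)=\lambda g^*(\frac1{\lambda n}A\alpha)$ and $h_i(a)=\frac1n\phi_i^*(-a)$, step size $\gamma=\frac{c}{L_c\tau^2}$ and momentum parameter $\theta=\frac{-\gamma\mu+\sqrt{\gamma^2\mu^2+4\gamma\mu}}{2n}$: starting from $\alpha^0=z^0=0$, for $k=0,1,\dots$, * $y^k=(1-\theta)\alpha^k+\theta z^k$; * $w^{j(k)}=y^{j(k)}+\sum_{l=j(k)+1}^{k}(1-\theta)^{k-l+1}\,(y^{j(k)}-\alpha^{j(k)})$, where the read time $j(k)\in\{k-\tau,\dots,k\}$, $j(k)\ge0$, may depend on everything that happened before iteration $k$; * $i_k$ is chosen uniformly in $\{1,\dots,n\}$, independently of the past and of $j(k)$; * $\delta^k=\arg\min_{\delta\in\mathbb R}\ h_{i_k}(z^k_{i_k}+\delta)+\nabla_{i_k}f(w^{j(k)})\,\delta+\frac{n\theta}{2\gamma}\delta^2$; * $z^{k+1}_{i_k}=z^k_{i_k}+\delta^k$, with the other coordinates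 unchanged; * $\alpha^{k+1}=(1-\theta)\alpha^k+n\theta z^{k+1}-(n-1)\theta z^k$. Count one oracle call per iteration (one partial derivative, that is one sample) and $n$ calls for forming the primal point at the end, so $K+n$ calls for $K$ iterations. Then for every $\epsilon>0$ and every $K$ such that $$K+n\ \ge\ C\left(n+\tau\sqrt{\frac{nR^2L_2}{\lambda}}\ \log\frac{M}{\epsilon}\right),\qquad M=\Big(1+\frac{R^2L_2}{\lambda}\Big)^3\big(D^*-D(0)\big),$$ (when $M=0$ the logarithmic term is read as $0$) both the expected dual gap and the expected primal gap are at most $\epsilon$: $$\mathbb E\,[D^*-D(\alpha^K)]\le\epsilon\qquad\text{and}\qquad \mathbb E\,[P(x(\alpha^K))-P^*]\le\epsilon .$$ Hence $O\Big(n+\tau\sqrt{\frac{nR^2L_2}{\lambda}}\log\frac1\epsilon\Big)$ oracle calls suffice as $\epsilon\to0$, with an absolute constant in the $O$. -/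

import Mathlib

open MeasureTheory ProbabilityTheory

noncomputable section

/-- The Fenchel conjugate `s ↦ sup_u (⟪s, u⟫ - ψ u)` of a real-valued function, with values in
the extended reals. -/
def fenchelConj {E : Type*} [NormedAddCommGroup E] [InnerProductSpace ℝ E]
    (ψ : E → ℝ) (s : E) : EReal :=
  ⨆ u : E, ((inner ℝ s u - ψ u : ℝ) : EReal)

/-- A function on the line is `L`-smooth: differentiable, with `L`-Lipschitz derivative. -/
def IsLSmooth (L : ℝ) (ψ : ℝ → ℝ) : Prop :=
  Differentiable ℝ ψ ∧ ∀ u v : ℝ, |deriv ψ u - deriv ψ v| ≤ L * |u - v|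

/-- The data of a regularized empirical risk minimization problem with `n` samples in dimension
`d`: the losses `φ i`, the regularizer `g`, the sample vectors `A i` (the columns of the data
matrix) and the regularization weight `lam`. -/
structure ERM (n d : ℕ) where
  φ : Fin n → ℝ → ℝ
  g : EuclideanSpace ℝ (Fin d) → ℝ
  A : Fin n → EuclideanSpace ℝ (Fin d)
  lam : ℝ

namespace ERM

variable {n d : ℕ} (p : ERM n d)

/-- The primal objective `P x = (1/n) ∑ i, φ i (A iᵀ x) + lam * g x`. -/
def primal (x : EuclideanSpace ℝ (Fin d)) : ℝ :=
  (1 / (n : ℝ)) * ∑ i, p.φ i (inner ℝ (p.A i) x) + p.lam * p.g x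

/-- The optimal primal value `P* = inf P`. -/
def primalOpt : ℝ := ⨅ x, p.primal x

/-- The vector `(1 / (lam n)) A α`. -/
def dualMap (α : EuclideanSpace ℝ (Fin n)) : EuclideanSpace ℝ (Fin d) :=
  (1 / (p.lam * (n : ℝ))) • ∑ i, α i • p.A i

/-- The smooth part `f α = lam * g* ((1 / (lam n)) A α)` of the negated dual objective. -/
def dualSmooth (α : EuclideanSpace ℝ (Fin n)) : ℝ :=
  p.lam * (fenchelConj p.g (p.dualMap α)).toReal

/-- The separable part of the negated dual objective: `h i a = (1/n) (φ i)* (-a)`. -/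
def dualSep (i : Fin n) (a : ℝ) : EReal :=
  ((1 / (n : ℝ) : ℝ) : EReal) * fenchelConj (p.φ i) (-a)

/-- The dual objective, to be maximized:
`D α = -(1/n) ∑ i, (φ i)* (-α i) - lam * g* ((1 / (lam n)) A α)`. -/
def dual (α : EuclideanSpace ℝ (Fin n)) : EReal :=
  -(∑ i, p.dualSep i (α i) + (p.dualSmooth α : EReal))

/-- The optimal dual value `D* = sup D`. -/
def dualOpt : EReal := ⨆ α, p.dual α

/-- The primal point attached to a dual point: `x = ∇g* ((1 / (lam n)) A α)`. -/
def primalPoint (α : EuclideanSpace ℝ (Fin n)) : EuclideanSpace ℝ (Fin d) :=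
  gradient (fun v => (fenchelConj p.g v).toReal) (p.dualMap α)

end ERM

/-- The trajectories of AASCD (accelerated asynchronous stochastic coordinate descent) for the
problem `min f x + ∑ i, h i (x i)`, with step size `γ`, constant momentum parameter `θ`, chosen
coordinates `i 0, i 1, …` and read times `j 0, j 1, …`. The partial derivative in iteration `k` is
taken at the momentum-compensated point `w k`, which is computed from the state at time `j k`. -/
structure IsAASCDRun {n : ℕ} (f : EuclideanSpace ℝ (Fin n) → ℝ) (h : Fin n → ℝ → EReal)
    (γ θ : ℝ) (i : ℕ → Fin n) (j : ℕ → ℕ) (x y z w : ℕ → EuclideanSpace ℝ (Fin n)) : Prop where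
  x_zero : x 0 = 0
  z_zero : z 0 = 0
  y_eq : ∀ k, y k = (1 - θ) • x k + θ • z k
  w_eq : ∀ k, w k = y (j k) +
    (∑ l ∈ Finset.Icc (j k + 1) k, (1 - θ) ^ (k - l + 1)) • (y (j k) - x (j k))
  z_step : ∀ k, IsMinOn
    (fun δ : ℝ => h (i k) (z k (i k) + δ) +
      ((gradient f (w k) (i k) * δ + (n : ℝ) * θ / (2 * γ) * δ ^ 2 : ℝ) : EReal))
    Set.univ (z (k + 1) (i k) - z k (i k))
  z_rest : ∀ k l, l ≠ i k → z (k + 1) l = z k l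
  x_step : ∀ k, x (k + 1) =
    (1 - θ) • x k + ((n : ℝ) * θ) • z (k + 1) - (((n : ℝ) - 1) * θ) • z k

/-- The random schedule: in iteration `k` the read time `j k` lies in `{k - τ, …, k}` and is
determined by the past `ℱ k`; the coordinate `i k` is uniform and independent of the past. -/
structure IsSchedule {Ω : Type*} [mΩ : MeasurableSpace Ω] {n : ℕ} (P : Measure Ω)
    (ℱ : Filtration ℕ mΩ) (τ : ℕ) (i : ℕ → Ω → Fin n) (j : ℕ → Ω → ℕ) : Prop where
  read_le : ∀ k ω, j k ω ≤ k
  le_read : ∀ k ω, k ≤ j k ω + τ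
  read_meas : ∀ k, Measurable[ℱ k] (j k)
  index_meas : ∀ k, Measurable[ℱ (k + 1)] (i k)
  index_uniform : ∀ k a, P {ω | i k ω = a} = (n : ENNReal)⁻¹
  index_indep : ∀ k, Indep (MeasurableSpace.comap (i k) ⊤) (ℱ k) P

/-- The coordinate Lipschitz constant `R² / (lam n²)` of the smooth part of the dual. -/
def coordLip (n : ℕ) (R lam : ℝ) : ℝ := R ^ 2 / (lam * (n : ℝ) ^ 2)

/-- The strong convexity modulus `1 / (n L₂)` of the separable part of the dual. -/
def strongMod (n : ℕ) (L₂ : ℝ) : ℝ := 1 / ((n : ℝ) * L₂)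

/-- The step size `c / (L_c τ²)`. -/
def stepSize (c : ℝ) (n τ : ℕ) (R lam : ℝ) : ℝ := c / (coordLip n R lam * (τ : ℝ) ^ 2)

/-- The momentum parameter: the positive root of `n² θ² + n γ μ θ = γ μ`. -/
def momentum (n : ℕ) (γ μ : ℝ) : ℝ :=
  (-(γ * μ) + Real.sqrt ((γ * μ) ^ 2 + 4 * (γ * μ))) / (2 * (n : ℝ))

/-- Oracle calls for `K` iterations and the recovery of a primal point: one partial derivative,
that is one sample, per iteration, and one pass over the `n` samples at the end. -/
def oracleCalls (n K : ℕ) : ℕ := K + n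

end

/-! The negated dual is treated as a composite problem `f + ∑ h i`. Here `f` is convex and smooth
for the ℓ¹ norm with the coordinate constant `L`, because `‖∑ v l • A l‖ ≤ R ∑ |v l|`, and each `h
i` is `μ`-strongly convex, because conjugation turns smoothness into strong convexity.

The iterate `x k` is a combination of `z 0, …, z k` with weights that are nonnegative when `n θ ≤ 1`
(`IsAASCDRun.x_eq`). In the Lyapunov function `potential`, the separable part at `x k` is therefore
replaced by the same combination of its values at the `z s`, which bounds it from above and changes
simply in one step. The equation defining `θ` makes the quadratic gained in the proximal step
reproduce `μ / 2 * ‖z - u‖ ^ 2`. Averaging over the uniform coordinate and using convexity of `f` at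
`w k` then contracts the potential by `1 - θ`, up to the error of evaluating the gradient at `w k`.

That error is small because, when no coordinate is updated, `y - x` just decays by the factor `1 -
θ` (`IsAASCDRun.momentum_succ`). The extrapolation in `w k` follows this motion exactly, so it
misses only the updates since the read. Each update moves one coordinate, so in ℓ¹ the distance from
`w k` to `x (k + 1)` is at most `2 n θ` times the sum of the last `τ + 1` step lengths. The squared
steps are paid for by the negative term `(n θ)² / (2 γ)` times the squared step, which the proximal
steps leave over. The balance needs `L (τ + 1)² γ` to be small (`le_pow_mul_of_delayed_descent`).

The initial potential is bounded by three initial dual gaps without a dual minimizer, by strong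
convexity at a midpoint (`IsCoordComposite.midpoint_zero_le`). The primal gap is at most `1 + R² L₂
/ lam` dual gaps: a damped step towards the dual point built from the loss derivatives gains that
fraction of the duality gap (`ERM.exists_gap_le`). Finally `θ` is at least a constant times `(τ √(n
R² L₂ / lam))⁻¹`, and the linear rate gives the iteration count. -/

noncomputable section

/-! ### Tangent inequalities, growth at minimizers, and existence of minimizers -/

section Convexity

theorem ConvexOn.add_deriv_mul_le {f : ℝ → ℝ} (hf : ConvexOn ℝ Set.univ f) {x : ℝ}
    (hd : DifferentiableAt ℝ f x) (y : ℝ) : f x + deriv f x * (y - x) ≤ f y := by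
  rcases lt_trichotomy x y with h | rfl | h
  · have := hf.deriv_le_slope (Set.mem_univ x) (Set.mem_univ y) h hd
    rw [slope_def_field, le_div_iff₀ (sub_pos.2 h)] at this
    linarith
  · simp
  · have := hf.slope_le_deriv (Set.mem_univ y) (Set.mem_univ x) h hd
    rw [slope_def_field, div_le_iff₀ (sub_pos.2 h)] at this
    linarith

/-- The function `L / 2 * t ^ 2 - ψ t` has a monotone derivative, hence is convex and lies above its
tangents; convexity of `ψ` plays no role. -/
theorem IsLSmooth.le_quadratic {L : ℝ} {ψ : ℝ → ℝ} (h : IsLSmooth L ψ) (u v : ℝ) :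
    ψ v ≤ ψ u + deriv ψ u * (v - u) + L / 2 * (v - u) ^ 2 := by
  obtain ⟨hd, hL⟩ := h
  have hder : ∀ t, HasDerivAt (fun t => L / 2 * t ^ 2 - ψ t) (L * t - deriv ψ t) t := fun t => by
    have := ((hasDerivAt_pow 2 t).const_mul (L / 2)).sub (hd t).hasDerivAt
    refine this.congr_deriv ?_
    push_cast
    ring
  have hmono : Monotone (deriv fun t => L / 2 * t ^ 2 - ψ t) := fun a b hab => by
    rw [(hder a).deriv, (hder b).deriv]
    have := (abs_le.1 (hL b a)).2
    rw [abs_of_nonneg (sub_nonneg.2 hab)] at this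
    linarith
  have hdiff : Differentiable ℝ fun t => L / 2 * t ^ 2 - ψ t :=
    fun t => (hder t).differentiableAt
  have := (hmono.convexOn_univ_of_deriv hdiff).add_deriv_mul_le (hdiff u) v
  rw [(hder u).deriv] at this
  nlinarith

/-- Compare the minimum with the point at fraction `t` of the way to `u`, divide by `t`, and let `t`
tend to `0`. -/
theorem StrongConvexOn.add_sq_le_of_isMinOn {E : Type*} [NormedAddCommGroup E] [NormedSpace ℝ E]
    {S : Set E} {m : ℝ} {f : E → ℝ} (hf : StrongConvexOn S m f) {x u : E} (hx : x ∈ S)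
    (hu : u ∈ S) (hmin : IsMinOn f S x) : f x + m / 2 * ‖u - x‖ ^ 2 ≤ f u := by
  have key : ∀ t ∈ Set.Ioo (0 : ℝ) 1, f x + (1 - t) * (m / 2 * ‖u - x‖ ^ 2) ≤ f u := by
    rintro t ⟨ht0, ht1⟩
    have h1 := hf.2 hu hx ht0.le (sub_nonneg.2 ht1.le) (by ring)
    have h2 : f x ≤ f (t • u + (1 - t) • x) :=
      hmin (hf.1 hu hx ht0.le (sub_nonneg.2 ht1.le) (by ring))
    simp only [smul_eq_mul] at h1
    have h3 : t * (f x + (1 - t) * (m / 2 * ‖u - x‖ ^ 2)) ≤ t * f u := by linarith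
    exact le_of_mul_le_mul_left h3 ht0
  have hlim : Filter.Tendsto (fun t : ℝ => f x + (1 - t) * (m / 2 * ‖u - x‖ ^ 2))
      (nhdsWithin 0 (Set.Ioi 0)) (nhds (f x + (1 - 0) * (m / 2 * ‖u - x‖ ^ 2))) := by
    apply Filter.Tendsto.mono_left _ nhdsWithin_le_nhds
    exact Continuous.tendsto (by fun_prop) 0
  have := le_of_tendsto hlim
    (Filter.mem_of_superset (Ioo_mem_nhdsGT (zero_lt_one)) key)
  simpa using this

theorem StrongConvexOn.exists_isMinOn_univ {E : Type*} [NormedAddCommGroup E] [NormedSpace ℝ E]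
    [FiniteDimensional ℝ E] {m : ℝ} (hm : 0 < m) {f : E → ℝ}
    (hf : StrongConvexOn Set.univ m f) : ∃ x, IsMinOn f Set.univ x := by
  have hcont : Continuous f := by
    rw [← continuousOn_univ]
    exact (hf.convexOn fun r => by positivity).continuousOn isOpen_univ
  obtain ⟨b, -, hb⟩ := (isCompact_closedBall (0 : E) 1).exists_isMinOn
    ⟨0, Metric.mem_closedBall_self zero_le_one⟩ hcont.continuousOn
  -- The point `u / ‖u‖` lies in the unit ball, where `f b` is a lower bound. Strong convexity on
  -- the segment from `0` to `u` through it forces quadratic growth, so sublevel sets are bounded.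
  have hgrow : ∀ u : E, 1 ≤ ‖u‖ →
      f 0 + ‖u‖ * (f b - f 0) + m / 2 * (‖u‖ - 1) * ‖u‖ ≤ f u := by
    intro u hu
    have hpos : 0 < ‖u‖ := by linarith
    have h1 := hf.2 (Set.mem_univ u) (Set.mem_univ 0) (inv_nonneg.2 hpos.le)
      (sub_nonneg.2 (inv_le_one_of_one_le₀ hu)) (by ring)
    have h2 : f b ≤ f (‖u‖⁻¹ • u + (1 - ‖u‖⁻¹) • (0 : E)) := by
      apply hb
      simp [norm_smul, hpos.ne']
    simp only [smul_eq_mul, sub_zero] at h1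
    have h3 := mul_le_mul_of_nonneg_left (h2.trans h1) hpos.le
    have h4 : ‖u‖ * (‖u‖⁻¹ * f u + (1 - ‖u‖⁻¹) * f 0
        - ‖u‖⁻¹ * (1 - ‖u‖⁻¹) * (m / 2 * ‖u‖ ^ 2)) =
        f u + (‖u‖ - 1) * f 0 - m / 2 * (‖u‖ - 1) * ‖u‖ := by
      field_simp
    rw [h4] at h3
    linarith
  suffices hsub : {u | f u ≤ f 0} ⊆ Metric.closedBall 0 (1 + 2 * |f b - f 0| / m) by
    have := FiniteDimensional.proper_real E
    obtain ⟨x, hx⟩ := hcont.exists_forall_le_of_isBounded 0 (Metric.isBounded_closedBall.subset hsub)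
    exact ⟨x, fun y _ => hx y⟩
  · intro u hu
    rw [mem_closedBall_zero_iff]
    by_contra! hlt
    have h0 : 0 ≤ 2 * |f b - f 0| / m := by positivity
    have h1 : 1 ≤ ‖u‖ := by linarith
    have h2 := hgrow u h1
    have h3 : |f b - f 0| < m / 2 * (‖u‖ - 1) := by
      have : 2 * |f b - f 0| / m < ‖u‖ - 1 := by linarith
      rw [div_lt_iff₀ hm] at this
      linarith
    have h4 := neg_abs_le (f b - f 0)
    have h5 : f u ≤ f 0 := hu
    nlinarith

end Convexity

/-! ### Fenchel conjugates: smoothness and strong convexity exchanged -/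

section Conjugate

variable {E : Type*} [NormedAddCommGroup E] [InnerProductSpace ℝ E] {ψ : E → ℝ}

theorem le_fenchelConj (ψ : E → ℝ) (s u : E) :
    ((inner ℝ s u - ψ u : ℝ) : EReal) ≤ fenchelConj ψ s :=
  le_iSup (fun u : E => ((inner ℝ s u - ψ u : ℝ) : EReal)) u

theorem fenchelConj_le_coe_iff {s : E} {r : ℝ} :
    fenchelConj ψ s ≤ (r : EReal) ↔ ∀ u, inner ℝ s u - ψ u ≤ r := by
  simp only [fenchelConj, iSup_le_iff, EReal.coe_le_coe_iff]

theorem fenchelConj_ne_bot (ψ : E → ℝ) (s : E) : fenchelConj ψ s ≠ ⊥ :=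
  ne_bot_of_le_ne_bot (EReal.coe_ne_bot _) (le_fenchelConj ψ s 0)

theorem coe_toReal_fenchelConj {s : E} (hs : fenchelConj ψ s ≠ ⊤) :
    ((fenchelConj ψ s).toReal : EReal) = fenchelConj ψ s :=
  EReal.coe_toReal hs (fenchelConj_ne_bot ψ s)

theorem inner_sub_le_toReal_fenchelConj {s : E} (hs : fenchelConj ψ s ≠ ⊤) (u : E) :
    inner ℝ s u - ψ u ≤ (fenchelConj ψ s).toReal := by
  rw [← EReal.coe_le_coe_iff, coe_toReal_fenchelConj hs]
  exact le_fenchelConj ψ s u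

/-- If `u` attains the supremum defining the conjugate, the conjugate is its value there. -/
theorem fenchelConj_eq_of_forall_le {s u : E}
    (h : ∀ v, inner ℝ s v - ψ v ≤ inner ℝ s u - ψ u) :
    fenchelConj ψ s = ((inner ℝ s u - ψ u : ℝ) : EReal) :=
  le_antisymm (fenchelConj_le_coe_iff.2 h) (le_fenchelConj ψ s u)

/-- Smoothness sharpens the Fenchel–Young inequality by `(t - ψ' u)² / (2 L)`. Averaging the
sharpened inequalities at `s` and `s'` for a common `u`, the variance identity for these squares
leaves exactly the strong convexity term; then take the supremum over `u`. -/
theorem IsLSmooth.strongConvexOn_toReal_fenchelConj {L : ℝ} (hL : 0 < L) {ψ : ℝ → ℝ}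
    (h : IsLSmooth L ψ) :
    StrongConvexOn {s | fenchelConj ψ s ≠ ⊤} (1 / L) (fun s => (fenchelConj ψ s).toReal) := by
  have key : ∀ s, fenchelConj ψ s ≠ ⊤ → ∀ s', fenchelConj ψ s' ≠ ⊤ → ∀ a b : ℝ, 0 ≤ a → 0 ≤ b →
      a + b = 1 → fenchelConj ψ (a • s + b • s') ≤
      ((a * (fenchelConj ψ s).toReal + b * (fenchelConj ψ s').toReal
        - a * b * (1 / L / 2 * ‖s - s'‖ ^ 2) : ℝ) : EReal) := by
    intro s hs s' hs' a b ha hb hab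
    rw [fenchelConj_le_coe_iff]
    intro u
    have bound : ∀ t, fenchelConj ψ t ≠ ⊤ →
        t * u - ψ u + (t - deriv ψ u) ^ 2 / (2 * L) ≤ (fenchelConj ψ t).toReal := by
      intro t ht
      -- The test point maximizes `t * v` minus the quadratic upper model of `ψ` at `u`.
      have h1 := inner_sub_le_toReal_fenchelConj ht (u + (t - deriv ψ u) / L)
      have h2 := h.le_quadratic u (u + (t - deriv ψ u) / L)
      simp only [RCLike.inner_apply, conj_trivial] at h1
      have h3 : t * u - ψ u + (t - deriv ψ u) ^ 2 / (2 * L) =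
          (u + (t - deriv ψ u) / L) * t - (ψ u + deriv ψ u * (u + (t - deriv ψ u) / L - u)
            + L / 2 * (u + (t - deriv ψ u) / L - u) ^ 2) := by
        field_simp
        ring
      linarith
    have h1 := mul_le_mul_of_nonneg_left (bound s hs) ha
    have h2 := mul_le_mul_of_nonneg_left (bound s' hs') hb
    obtain rfl : b = 1 - a := by linarith
    simp only [RCLike.inner_apply, conj_trivial,
      smul_eq_mul, Real.norm_eq_abs, sq_abs]
    have h3 : 0 ≤ (a * s + (1 - a) * s' - deriv ψ u) ^ 2 / (2 * L) := by positivity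
    have h4 : a * ((s - deriv ψ u) ^ 2 / (2 * L)) + (1 - a) * ((s' - deriv ψ u) ^ 2 / (2 * L)) =
        (a * s + (1 - a) * s' - deriv ψ u) ^ 2 / (2 * L)
          + a * (1 - a) * (1 / L / 2 * (s - s') ^ 2) := by
      field_simp
      ring
    linarith
  have hconv : ∀ s, fenchelConj ψ s ≠ ⊤ → ∀ s', fenchelConj ψ s' ≠ ⊤ → ∀ a b : ℝ, 0 ≤ a → 0 ≤ b →
      a + b = 1 → fenchelConj ψ (a • s + b • s') ≠ ⊤ := fun s hs s' hs' a b ha hb hab =>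
    ne_top_of_le_ne_top (EReal.coe_ne_top _) (key s hs s' hs' a b ha hb hab)
  refine ⟨fun s hs s' hs' a b ha hb hab => hconv s hs s' hs' a b ha hb hab,
    fun s hs s' hs' a b ha hb hab => ?_⟩
  have := key s hs s' hs' a b ha hb hab
  rw [← coe_toReal_fenchelConj (hconv s hs s' hs' a b ha hb hab), EReal.coe_le_coe_iff] at this
  simpa using this

theorem StrongConvexOn.sub_inner {S : Set E} {m : ℝ} {g : E → ℝ}
    (hg : StrongConvexOn S m g) (v : E) : StrongConvexOn S m fun u => g u - inner ℝ v u := by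
  refine ⟨hg.1, fun x hx y hy a b ha hb hab => ?_⟩
  have := hg.2 hx hy ha hb hab
  simp only [smul_eq_mul, inner_add_right, real_inner_smul_right] at this ⊢
  linarith

/-- For a `1`-strongly convex function on a finite-dimensional space, the conjugate is finite,
attained, and squeezed between its linearization and the linearization plus `‖·‖² / 2`. -/
theorem StrongConvexOn.exists_fenchelConj_eq [FiniteDimensional ℝ E] {g : E → ℝ}
    (hg : StrongConvexOn Set.univ 1 g) (v : E) :
    ∃ x, fenchelConj g v = ((inner ℝ v x - g x : ℝ) : EReal) ∧
      ∀ u, inner ℝ v u - g u ≤ inner ℝ v x - g x - 1 / 2 * ‖u - x‖ ^ 2 := by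
  obtain ⟨x, hx⟩ := (hg.sub_inner v).exists_isMinOn_univ one_pos
  have h : ∀ u, inner ℝ v u - g u ≤ inner ℝ v x - g x - 1 / 2 * ‖u - x‖ ^ 2 := fun u => by
    have := (hg.sub_inner v).add_sq_le_of_isMinOn (Set.mem_univ x) (Set.mem_univ u) hx
    linarith
  exact ⟨x, fenchelConj_eq_of_forall_le fun u => (h u).trans (sub_le_self _ (by positivity)), h⟩

theorem StrongConvexOn.fenchelConj_ne_top [FiniteDimensional ℝ E] {g : E → ℝ}
    (hg : StrongConvexOn Set.univ 1 g) (v : E) : fenchelConj g v ≠ ⊤ := by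
  obtain ⟨x, hx, -⟩ := hg.exists_fenchelConj_eq v
  rw [hx]
  exact EReal.coe_ne_top _

theorem hasGradientAt_of_quadratic_bounds {E : Type*} [NormedAddCommGroup E]
    [InnerProductSpace ℝ E] [CompleteSpace E] {f : E → ℝ} {x v : E} {M : ℝ} (hM : 0 ≤ M)
    (hlow : ∀ w, f v + inner ℝ (w - v) x ≤ f w)
    (hup : ∀ w, f w ≤ f v + inner ℝ (w - v) x + M * ‖w - v‖ ^ 2) : HasGradientAt f x v := by
  rw [hasGradientAt_iff_isLittleO]
  apply Asymptotics.IsBigO.trans_isLittleO (g := fun w => ‖w - v‖ ^ 2)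
  · apply Asymptotics.IsBigO.of_bound M
    refine Filter.Eventually.of_forall fun w => ?_
    rw [real_inner_comm, Real.norm_eq_abs, Real.norm_of_nonneg (by positivity), abs_le]
    have h1 := hlow w
    have h2 := hup w
    have h3 : 0 ≤ M * ‖w - v‖ ^ 2 := by positivity
    constructor <;> linarith
  · have h1 : Asymptotics.IsLittleO (nhds (0 : E)) (fun u : E => ‖u‖ ^ 2) fun u => u :=
      Asymptotics.isLittleO_norm_pow_id one_lt_two
    exact h1.comp_tendsto (tendsto_sub_nhds_zero_iff.2 Filter.tendsto_id)

/-- The gradient of the conjugate of a `1`-strongly convex function attains the supremum, and the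
conjugate is convex and `1`-smooth. -/
theorem StrongConvexOn.fenchelConj_gradient [FiniteDimensional ℝ E] {g : E → ℝ}
    (hg : StrongConvexOn Set.univ 1 g) (v : E) :
    (fenchelConj g v).toReal = inner ℝ v (gradient (fun v => (fenchelConj g v).toReal) v)
      - g (gradient (fun v => (fenchelConj g v).toReal) v) ∧
    (∀ w, (fenchelConj g v).toReal
      + inner ℝ (w - v) (gradient (fun v => (fenchelConj g v).toReal) v) ≤
        (fenchelConj g w).toReal) ∧
    ∀ w, (fenchelConj g w).toReal ≤ (fenchelConj g v).toReal
      + inner ℝ (w - v) (gradient (fun v => (fenchelConj g v).toReal) v) + 1 / 2 * ‖w - v‖ ^ 2 := by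
  obtain ⟨x, hx, hmax⟩ := hg.exists_fenchelConj_eq v
  have hv : (fenchelConj g v).toReal = inner ℝ v x - g x := by rw [hx, EReal.toReal_coe]
  have hlow : ∀ w, (fenchelConj g v).toReal + inner ℝ (w - v) x ≤ (fenchelConj g w).toReal := by
    intro w
    have := inner_sub_le_toReal_fenchelConj (hg.fenchelConj_ne_top w) x
    rw [inner_sub_left]
    linarith
  have hup : ∀ w, (fenchelConj g w).toReal ≤ (fenchelConj g v).toReal
      + inner ℝ (w - v) x + 1 / 2 * ‖w - v‖ ^ 2 := by
    intro w
    rw [← EReal.coe_le_coe_iff, coe_toReal_fenchelConj (hg.fenchelConj_ne_top w),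
      fenchelConj_le_coe_iff]
    intro u
    -- The quadratic decay away from the maximizer `x` absorbs the cross term `⟪w - v, u - x⟫` by
    -- Young's inequality, at the cost of `‖w - v‖² / 2`.
    have h1 := hmax u
    have h2 := real_inner_le_norm (w - v) (u - x)
    have h3 := sq_nonneg (‖w - v‖ - ‖u - x‖)
    have h4 : inner ℝ w u = inner ℝ v u + inner ℝ (w - v) x + inner ℝ (w - v) (u - x) := by
      simp only [inner_sub_left, inner_sub_right]
      ring
    rw [hv, h4]
    nlinarith
  have : CompleteSpace E := FiniteDimensional.complete ℝ E
  rw [(hasGradientAt_of_quadratic_bounds (by norm_num) hlow hup).gradient]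
  exact ⟨hv, hlow, hup⟩

theorem ConvexOn.fenchelConj_deriv {ψ : ℝ → ℝ} (hψ : ConvexOn ℝ Set.univ ψ) {t : ℝ}
    (hd : DifferentiableAt ℝ ψ t) :
    fenchelConj ψ (deriv ψ t) = ((deriv ψ t * t - ψ t : ℝ) : EReal) := by
  rw [fenchelConj_eq_of_forall_le (u := t)]
  · simp [mul_comm]
  · intro v
    have := hψ.add_deriv_mul_le hd v
    simp only [RCLike.inner_apply, conj_trivial]
    linarith

end Conjugate

/-! ### Composite objectives and proximal steps -/

section Composite

variable {n : ℕ}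

/-- A composite objective `f + ∑ i, h i` on `ℝⁿ`: `f` is convex and `L`-smooth with respect to the
`ℓ¹` norm, and the `h i` are proper extended-valued functions, finite at `0`, and strongly convex
with modulus `μ` on their domains. -/
structure IsCoordComposite (f : EuclideanSpace ℝ (Fin n) → ℝ) (h : Fin n → ℝ → EReal)
    (L μ : ℝ) : Prop where
  convex : ∀ a b, f a + ∑ l, gradient f a l * (b l - a l) ≤ f b
  smooth : ∀ a b, f b ≤ f a + ∑ l, gradient f a l * (b l - a l) + L / 2 * (∑ l, |b l - a l|) ^ 2
  ne_bot : ∀ l a, h l a ≠ ⊥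
  strong : ∀ l, StrongConvexOn {a | h l a ≠ ⊤} μ fun a => (h l a).toReal
  zero_ne_top : ∀ l, h l 0 ≠ ⊤

/-- The domain of a separable function. -/
def sepDom (h : Fin n → ℝ → EReal) : Set (EuclideanSpace ℝ (Fin n)) :=
  {a | ∀ l, h l (a l) ≠ ⊤}

/-- The value of a separable function on its domain. -/
def sepSum (h : Fin n → ℝ → EReal) (a : EuclideanSpace ℝ (Fin n)) : ℝ :=
  ∑ l, (h l (a l)).toReal

theorem strongConvexOn_sepSum {h : Fin n → ℝ → EReal} {μ : ℝ}
    (hs : ∀ l, StrongConvexOn {a | h l a ≠ ⊤} μ fun a => (h l a).toReal) :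
    StrongConvexOn (sepDom h) μ (sepSum h) := by
  refine ⟨fun x hx y hy a b ha hb hab l => (hs l).1 (hx l) (hy l) ha hb hab,
    fun x hx y hy a b ha hb hab => ?_⟩
  have := Finset.sum_le_sum fun l (_ : l ∈ Finset.univ) => (hs l).2 (hx l) (hy l) ha hb hab
  refine this.trans_eq ?_
  simp only [sepSum, smul_eq_mul, EuclideanSpace.real_norm_sq_eq, Finset.sum_add_distrib,
    Finset.sum_sub_distrib, Finset.mul_sum, Real.norm_eq_abs, sq_abs, PiLp.sub_apply]

theorem EReal.sum_coe_toReal {ι : Type*} (s : Finset ι) {F : ι → EReal}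
    (htop : ∀ l, F l ≠ ⊤) (hbot : ∀ l, F l ≠ ⊥) :
    ((∑ l ∈ s, (F l).toReal : ℝ) : EReal) = ∑ l ∈ s, F l := by
  induction s using Finset.cons_induction with
  | empty => simp
  | cons a s ha ih => rw [Finset.sum_cons, Finset.sum_cons, EReal.coe_add, ih,
      EReal.coe_toReal (htop a) (hbot a)]

/-- Rearranged, this bounds `μ * ‖u‖ ^ 2` by objective gaps of `u` and `0`, since the midpoint
cannot beat the infimum; no minimizer is needed. The linear terms of `f` at the midpoint cancel. -/
theorem IsCoordComposite.midpoint_zero_le {f : EuclideanSpace ℝ (Fin n) → ℝ}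
    {h : Fin n → ℝ → EReal} {L μ : ℝ} (hc : IsCoordComposite f h L μ)
    {u : EuclideanSpace ℝ (Fin n)} (hu : u ∈ sepDom h) :
    (1 / 2 : ℝ) • u ∈ sepDom h ∧ f ((1 / 2 : ℝ) • u) + sepSum h ((1 / 2 : ℝ) • u) ≤
      (f u + sepSum h u + (f 0 + sepSum h 0)) / 2 - μ / 8 * ‖u‖ ^ 2 := by
  have hs := strongConvexOn_sepSum hc.strong
  have h0 : (0 : EuclideanSpace ℝ (Fin n)) ∈ sepDom h := hc.zero_ne_top
  have hhalf : (0 : ℝ) ≤ 1 / 2 := by norm_num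
  have h1 := hs.1 hu h0 hhalf hhalf (by norm_num)
  have h2 := hs.2 hu h0 hhalf hhalf (by norm_num)
  simp only [smul_zero, add_zero, sub_zero, smul_eq_mul] at h1 h2
  refine ⟨h1, ?_⟩
  have h3 := hc.convex ((1 / 2 : ℝ) • u) u
  have h4 := hc.convex ((1 / 2 : ℝ) • u) 0
  have h5 : ∑ l, gradient f ((1 / 2 : ℝ) • u) l * (u l - ((1 / 2 : ℝ) • u) l) +
      ∑ l, gradient f ((1 / 2 : ℝ) • u) l * ((0 : EuclideanSpace ℝ (Fin n)) l
        - ((1 / 2 : ℝ) • u) l) = 0 := by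
    rw [← Finset.sum_add_distrib]
    refine Finset.sum_eq_zero fun l _ => ?_
    simp only [PiLp.smul_apply, PiLp.zero_apply, smul_eq_mul]
    ring
  linarith

/-- Quadratic growth of the objective of a proximal step away from its minimizer. -/
theorem prox_add_sq_le {H : ℝ → EReal} {μ g κ z δ : ℝ} (hbot : ∀ a, H a ≠ ⊥)
    (hs : StrongConvexOn {a | H a ≠ ⊤} μ fun a => (H a).toReal)
    (hmin : IsMinOn (fun δ : ℝ => H (z + δ) + ((g * δ + κ * δ ^ 2 : ℝ) : EReal)) Set.univ δ)
    (hz : H z ≠ ⊤) :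
    H (z + δ) ≠ ⊤ ∧ ∀ u, H u ≠ ⊤ →
      (H (z + δ)).toReal + g * δ + κ * δ ^ 2 + (μ / 2 + κ) * (u - (z + δ)) ^ 2 ≤
        (H u).toReal + g * (u - z) + κ * (u - z) ^ 2 := by
  have hle : ∀ u, H (z + δ) + ((g * δ + κ * δ ^ 2 : ℝ) : EReal) ≤
      H u + ((g * (u - z) + κ * (u - z) ^ 2 : ℝ) : EReal) := fun u => by
    have := hmin (Set.mem_univ (u - z))
    simpa using this
  have htop : H (z + δ) ≠ ⊤ := by
    intro htop
    have := hle z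
    rw [htop, EReal.top_add_coe, top_le_iff, ← EReal.coe_toReal hz (hbot z),
      ← EReal.coe_add] at this
    exact EReal.coe_ne_top _ this
  refine ⟨htop, fun u hu => ?_⟩
  -- The proximal quadratic adds its own curvature `2 * κ` to that of `H`.
  have hstrong : StrongConvexOn {a | H a ≠ ⊤} (μ + 2 * κ)
      fun a => (H a).toReal + g * (a - z) + κ * (a - z) ^ 2 := by
    refine ⟨hs.1, fun x hx y hy a b ha hb hab => ?_⟩
    have := hs.2 hx hy ha hb hab
    obtain rfl : b = 1 - a := by linarith
    simp only [smul_eq_mul, Real.norm_eq_abs, sq_abs] at this ⊢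
    linarith
  have := hstrong.add_sq_le_of_isMinOn (x := z + δ) (u := u) htop hu fun a ha => by
    have h1 := hle a
    rw [← EReal.coe_toReal ha (hbot a), ← EReal.coe_toReal htop (hbot _), ← EReal.coe_add,
      ← EReal.coe_add, EReal.coe_le_coe_iff] at h1
    simp only [Set.mem_ofPred_eq, add_sub_cancel_left]
    linarith
  simp only [Real.norm_eq_abs, sq_abs, add_sub_cancel_left] at this
  linarith

/-- Proximal steps are unique. -/
theorem prox_unique {H : ℝ → EReal} {μ g κ z δ δ' : ℝ} (hμ : 0 ≤ μ) (hκ : 0 < κ)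
    (hbot : ∀ a, H a ≠ ⊥) (hs : StrongConvexOn {a | H a ≠ ⊤} μ fun a => (H a).toReal)
    (hmin : IsMinOn (fun δ : ℝ => H (z + δ) + ((g * δ + κ * δ ^ 2 : ℝ) : EReal)) Set.univ δ)
    (hmin' : IsMinOn (fun δ : ℝ => H (z + δ) + ((g * δ + κ * δ ^ 2 : ℝ) : EReal)) Set.univ δ')
    (hz : H z ≠ ⊤) : δ = δ' := by
  obtain ⟨ht, h1⟩ := prox_add_sq_le hbot hs hmin hz
  obtain ⟨ht', h2⟩ := prox_add_sq_le hbot hs hmin' hz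
  have h3 := h1 _ ht'
  have h4 := h2 _ ht
  simp only [add_sub_cancel_left] at h3 h4
  have h5 : (μ + 2 * κ) * (δ - δ') ^ 2 ≤ 0 := by linarith
  have h6 : (δ - δ') ^ 2 ≤ 0 := nonpos_of_mul_nonpos_right h5 (by linarith)
  have h7 : δ - δ' = 0 := pow_eq_zero_iff two_ne_zero |>.1 (le_antisymm h6 (sq_nonneg _))
  linarith

end Composite

/-! ### Exponential averages and convexity -/

section ExpAvg

variable {V : Type*} [AddCommGroup V] [Module ℝ V]

/-- The exponential moving average of a sequence. -/
def expAvg (θ : ℝ) (a : ℕ → V) : ℕ → V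
  | 0 => a 0
  | k + 1 => (1 - θ) • expAvg θ a k + θ • a k

theorem ConvexOn.map_expAvg_le {S : Set V} {F : V → ℝ} (hF : ConvexOn ℝ S F) {θ : ℝ}
    (h0 : 0 ≤ θ) (h1 : θ ≤ 1) {a : ℕ → V} (ha : ∀ k, a k ∈ S) (k : ℕ) :
    expAvg θ a k ∈ S ∧ F (expAvg θ a k) ≤ expAvg θ (fun k => F (a k)) k := by
  induction k with
  | zero => exact ⟨ha 0, le_rfl⟩
  | succ k ih =>
    refine ⟨hF.1 ih.1 (ha k) (sub_nonneg.2 h1) h0 (by ring), ?_⟩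
    refine (hF.2 ih.1 (ha k) (sub_nonneg.2 h1) h0 (by ring)).trans ?_
    simp only [expAvg, smul_eq_mul]
    have := mul_le_mul_of_nonneg_left ih.2 (sub_nonneg.2 h1)
    linarith

end ExpAvg

/-! ### Pathwise dynamics: convex combinations and momentum compensation -/

namespace IsAASCDRun

variable {n : ℕ} {f : EuclideanSpace ℝ (Fin n) → ℝ} {h : Fin n → ℝ → EReal} {γ θ L μ : ℝ}
  {i : ℕ → Fin n} {j : ℕ → ℕ} {x y z w : ℕ → EuclideanSpace ℝ (Fin n)}

/-- The proximal step of iteration `k`. -/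
theorem isMinOn_step (hr : IsAASCDRun f h γ θ i j x y z w) (k : ℕ) :
    IsMinOn (fun δ : ℝ => h (i k) (z k (i k) + δ) +
      ((gradient f (w k) (i k) * δ + (n : ℝ) * θ / (2 * γ) * δ ^ 2 : ℝ) : EReal))
    Set.univ (z (k + 1) (i k) - z k (i k)) := hr.z_step k

theorem z_mem_sepDom (hr : IsAASCDRun f h γ θ i j x y z w) (hc : IsCoordComposite f h L μ)
    (k : ℕ) : z k ∈ sepDom h := by
  induction k with
  | zero => intro l; rw [hr.z_zero]; exact hc.zero_ne_top l
  | succ k ih =>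
    intro l
    by_cases hl : l = i k
    · subst hl
      have := (prox_add_sq_le (hc.ne_bot _) (hc.strong _) (hr.isMinOn_step k) (ih _)).1
      rwa [add_sub_cancel] at this
    · rw [hr.z_rest k l hl]
      exact ih l

/-- For `0 ≤ n * θ ≤ 1` and `0 ≤ θ ≤ 1` this is a convex combination of past `z`, although the
update of `x` subtracts a multiple of `z k`. It yields both feasibility of `x` and the bound on its
separable part. -/
theorem x_eq (hr : IsAASCDRun f h γ θ i j x y z w) (k : ℕ) :
    x k = (1 - n * θ) • expAvg θ z k + ((n : ℝ) * θ) • z k := by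
  induction k with
  | zero => simp [expAvg, hr.x_zero, hr.z_zero]
  | succ k ih =>
    rw [hr.x_step, ih, expAvg]
    module

theorem x_mem_sepDom (hr : IsAASCDRun f h γ θ i j x y z w) (hc : IsCoordComposite f h L μ)
    (hμ : 0 ≤ μ) (hθ0 : 0 ≤ θ) (hθ1 : θ ≤ 1) (hnθ : n * θ ≤ 1) (k : ℕ) :
    x k ∈ sepDom h ∧ sepSum h (x k) ≤
      (1 - n * θ) * expAvg θ (fun k => sepSum h (z k)) k + n * θ * sepSum h (z k) := by
  have hcv : ConvexOn ℝ (sepDom h) (sepSum h) :=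
    (strongConvexOn_sepSum hc.strong).convexOn fun r => by positivity
  obtain ⟨h1, h2⟩ := hcv.map_expAvg_le hθ0 hθ1 (hr.z_mem_sepDom hc) k
  have hn : 0 ≤ n * θ := by positivity
  rw [hr.x_eq k]
  refine ⟨hcv.1 h1 (hr.z_mem_sepDom hc k) (sub_nonneg.2 hnθ) hn (by ring),
    (hcv.2 h1 (hr.z_mem_sepDom hc k) (sub_nonneg.2 hnθ) hn (by ring)).trans ?_⟩
  simp only [smul_eq_mul]
  have := mul_le_mul_of_nonneg_left h2 (sub_nonneg.2 hnθ)
  linarith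

theorem x_succ_eq (hr : IsAASCDRun f h γ θ i j x y z w) (k : ℕ) :
    x (k + 1) = y k + ((n : ℝ) * θ) • (z (k + 1) - z k) := by
  rw [hr.x_step, hr.y_eq]
  module

/-- Without the update term the momentum decays by `1 - θ`; this explains the geometric sum in the
definition of `w`. -/
theorem momentum_succ (hr : IsAASCDRun f h γ θ i j x y z w) (k : ℕ) :
    y (k + 1) - x (k + 1) =
      (1 - θ) • (y k - x k) + (θ * (1 - n * θ)) • (z (k + 1) - z k) := by
  rw [hr.y_eq (k + 1), hr.x_succ_eq k, hr.y_eq k]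
  module

theorem w_eq_range (hr : IsAASCDRun f h γ θ i j x y z w) (k : ℕ) :
    w k = y (j k) + (∑ m ∈ Finset.range (k - j k), (1 - θ) ^ (m + 1)) • (y (j k) - x (j k)) := by
  rw [hr.w_eq k]
  congr 2
  rw [← Finset.Ico_add_one_right_eq_Icc, Finset.sum_Ico_eq_sum_range,
    ← Finset.sum_range_reflect]
  have : k + 1 - (j k + 1) = k - j k := by omega
  rw [this]
  refine Finset.sum_congr rfl fun m hm => ?_
  rw [Finset.mem_range] at hm
  congr 1
  omega

/-- Momentum compensation: extrapolating from time `a` misses only the later updates. -/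
theorem abs_extrapolation_le (hr : IsAASCDRun f h γ θ i j x y z w) (hθ0 : 0 ≤ θ) (hθ1 : θ ≤ 1)
    (hnθ : n * θ ≤ 1) (l : Fin n) (a t : ℕ) :
    |(y (a + t) - x (a + t)) l - (1 - θ) ^ t * (y a - x a) l| ≤
        θ * ∑ s ∈ Finset.range t, |z (a + s + 1) l - z (a + s) l| ∧
      |y (a + t) l - (y a l + (∑ m ∈ Finset.range t, (1 - θ) ^ (m + 1)) * (y a - x a) l)| ≤
        (n * θ + t * θ) * ∑ s ∈ Finset.range t, |z (a + s + 1) l - z (a + s) l| := by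
  induction t with
  | zero => simp
  | succ t ih =>
    obtain ⟨ih1, ih2⟩ := ih
    have hm := congrArg (fun v : EuclideanSpace ℝ (Fin n) => v l) (hr.momentum_succ (a + t))
    have hx := congrArg (fun v : EuclideanSpace ℝ (Fin n) => v l) (hr.x_succ_eq (a + t))
    simp only [PiLp.add_apply, PiLp.sub_apply, PiLp.smul_apply, smul_eq_mul] at hm hx ih1 ih2 ⊢
    rw [Finset.sum_range_succ, Finset.sum_range_succ, ← add_assoc a t 1]
    set S := ∑ s ∈ Finset.range t, |z (a + s + 1) l - z (a + s) l|
    have hS : 0 ≤ S := Finset.sum_nonneg fun _ _ => abs_nonneg _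
    set D := z (a + t + 1) l - z (a + t) l
    have hn0 : 0 ≤ n * θ := by positivity
    have h1 : |y (a + t + 1) l - x (a + t + 1) l - (1 - θ) ^ (t + 1) * (y a l - x a l)| ≤
        θ * (S + |D|) := by
      have : y (a + t + 1) l - x (a + t + 1) l - (1 - θ) ^ (t + 1) * (y a l - x a l) =
          (1 - θ) * (y (a + t) l - x (a + t) l - (1 - θ) ^ t * (y a l - x a l))
            + (θ * (1 - n * θ)) * D := by
        rw [hm]; ring
      rw [this]
      refine (abs_add_le _ _).trans ?_
      rw [abs_mul, abs_mul, abs_of_nonneg (sub_nonneg.2 hθ1),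
        abs_of_nonneg (mul_nonneg hθ0 (sub_nonneg.2 hnθ)), mul_add]
      apply add_le_add
      · calc (1 - θ) * _ ≤ 1 * (θ * S) := by gcongr; linarith
          _ = θ * S := one_mul _
      · gcongr
        exact mul_le_of_le_one_right hθ0 (by linarith)
    refine ⟨h1, ?_⟩
    have h2 : y (a + t + 1) l - (y a l + (∑ m ∈ Finset.range t, (1 - θ) ^ (m + 1)
          + (1 - θ) ^ (t + 1)) * (y a l - x a l)) =
        (y (a + t) l - (y a l + (∑ m ∈ Finset.range t, (1 - θ) ^ (m + 1)) * (y a l - x a l)))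
        + (y (a + t + 1) l - x (a + t + 1) l - (1 - θ) ^ (t + 1) * (y a l - x a l))
        + n * θ * D := by
      rw [hx]; ring
    rw [h2]
    refine (abs_add_three _ _ _).trans ?_
    rw [abs_mul, abs_of_nonneg hn0]
    have h3 : 0 ≤ t * θ * |D| := by positivity
    push_cast
    linarith

/-- The distance from the evaluation point of the partial derivative to the next iterate. -/
theorem sum_abs_x_succ_sub_w_le (hr : IsAASCDRun f h γ θ i j x y z w) (hθ0 : 0 ≤ θ) (hθ1 : θ ≤ 1)
    (hnθ : n * θ ≤ 1) {τ : ℕ} (hτ : τ ≤ n) {k : ℕ} (hj : j k ≤ k) (hjτ : k ≤ j k + τ) :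
    ∑ l, |x (k + 1) l - w k l| ≤
      2 * (n * θ) * ∑ s ∈ Finset.Ico (k - τ) (k + 1), |z (s + 1) (i s) - z s (i s)| := by
  have hn0 : 0 ≤ n * θ := by positivity
  have hcoord : ∀ l, |x (k + 1) l - w k l| ≤
      2 * (n * θ) * ∑ s ∈ Finset.Ico (k - τ) (k + 1), |z (s + 1) l - z s l| := by
    intro l
    have h1 := (hr.abs_extrapolation_le hθ0 hθ1 hnθ l (j k) (k - j k)).2
    rw [Nat.add_sub_cancel' hj] at h1
    have hw := congrArg (fun v : EuclideanSpace ℝ (Fin n) => v l) (hr.w_eq_range k)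
    have hx := congrArg (fun v : EuclideanSpace ℝ (Fin n) => v l) (hr.x_succ_eq k)
    simp only [PiLp.add_apply, PiLp.sub_apply, PiLp.smul_apply, smul_eq_mul] at hw hx h1
    rw [← hw] at h1
    -- The delay is at most `τ ≤ n`, so the momentum error `t * θ` is no larger than the direct
    -- error `n * θ`.
    have h2 : (n * θ + ((k - j k : ℕ) : ℝ) * θ) ≤ 2 * (n * θ) := by
      have : ((k - j k : ℕ) : ℝ) ≤ n := by
        exact_mod_cast (by omega : k - j k ≤ n)
      nlinarith
    have h3 : ∑ s ∈ Finset.range (k - j k), |z (j k + s + 1) l - z (j k + s) l|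
        ≤ ∑ s ∈ Finset.Ico (k - τ) k, |z (s + 1) l - z s l| := by
      rw [← Finset.sum_Ico_eq_sum_range (fun s => |z (s + 1) l - z s l|)]
      apply Finset.sum_le_sum_of_subset_of_nonneg
      · exact Finset.Ico_subset_Ico (by omega) le_rfl
      · intros; positivity
    have h4 : (n * θ + ((k - j k : ℕ) : ℝ) * θ) *
        ∑ s ∈ Finset.range (k - j k), |z (j k + s + 1) l - z (j k + s) l| ≤
        2 * (n * θ) * ∑ s ∈ Finset.Ico (k - τ) k, |z (s + 1) l - z s l| := by
      gcongr
    rw [Finset.sum_Ico_succ_top (Nat.sub_le k τ), hx]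
    have h5 : y k l + n * θ * (z (k + 1) l - z k l) - w k l =
      (y k l - w k l) + n * θ * (z (k + 1) l - z k l) := by ring
    rw [h5]
    refine (abs_add_le _ _).trans ?_
    rw [abs_mul, abs_of_nonneg hn0]
    have : 0 ≤ n * θ * |z (k + 1) l - z k l| := by positivity
    linarith
  refine (Finset.sum_le_sum fun l _ => hcoord l).trans_eq ?_
  rw [← Finset.mul_sum, Finset.sum_comm]
  congr 1
  refine Finset.sum_congr rfl fun s _ => ?_
  -- Iteration `s` moves only coordinate `i s`, so passing to the ℓ¹ norm costs no factor `n`.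
  rw [Finset.sum_eq_single (i s)]
  · intro l _ hl
    rw [hr.z_rest s l hl, sub_self, abs_zero]
  · simp

end IsAASCDRun

theorem Finset.sum_eq_sum_add_sub_of_forall_ne {ι : Type*} [Fintype ι] {F G : ι → ℝ}
    (i : ι) (h : ∀ l, l ≠ i → F l = G l) : ∑ l, F l = ∑ l, G l + (F i - G i) := by
  rw [← sub_eq_iff_eq_add', ← Finset.sum_sub_distrib]
  exact Finset.sum_eq_single i (fun l _ hl => by rw [h l hl, sub_self]) (by simp)

/-! ### The Lyapunov function and its one-step change -/

section Potential

variable {n : ℕ}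

/-- The Lyapunov function of AASCD relative to the reference point `u`. -/
def potential (f : EuclideanSpace ℝ (Fin n) → ℝ) (h : Fin n → ℝ → EReal) (θ μ : ℝ)
    (u : EuclideanSpace ℝ (Fin n)) (x z : ℕ → EuclideanSpace ℝ (Fin n)) (k : ℕ) : ℝ :=
  f (x k) + ((1 - n * θ) * expAvg θ (fun s => sepSum h (z s)) k + n * θ * sepSum h (z k))
    - (f u + sepSum h u) + μ / 2 * ‖z k - u‖ ^ 2

/-- The part of the bound on the next potential that does not depend on the chosen coordinate. -/
def potentialBase (f : EuclideanSpace ℝ (Fin n) → ℝ) (h : Fin n → ℝ → EReal) (θ μ : ℝ)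
    (u : EuclideanSpace ℝ (Fin n)) (y z w : ℕ → EuclideanSpace ℝ (Fin n)) (k : ℕ) : ℝ :=
  f (w k) + ∑ l, gradient f (w k) l * (y k l - w k l)
    + (1 - θ) * ((1 - n * θ) * expAvg θ (fun s => sepSum h (z s)) k + n * θ * sepSum h (z k))
    + θ * sepSum h (z k) - (f u + sepSum h u) + μ / 2 * ‖z k - u‖ ^ 2

/-- The contribution of coordinate `a` to the bound on the next potential. -/
def potentialGain (f : EuclideanSpace ℝ (Fin n) → ℝ) (h : Fin n → ℝ → EReal) (θ μ : ℝ)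
    (u zk wk : EuclideanSpace ℝ (Fin n)) (a : Fin n) : ℝ :=
  θ * ((h a (u a)).toReal - (h a (zk a)).toReal + gradient f wk a * (u a - zk a))
    - θ * μ / 2 * (u a - zk a) ^ 2

end Potential

namespace IsAASCDRun

variable {n : ℕ} {f : EuclideanSpace ℝ (Fin n) → ℝ} {h : Fin n → ℝ → EReal} {γ θ L μ : ℝ}
  {i : ℕ → Fin n} {j : ℕ → ℕ} {x y z w : ℕ → EuclideanSpace ℝ (Fin n)}

theorem potentialBase_add_sum_le (hr : IsAASCDRun f h γ θ i j x y z w)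
    (hc : IsCoordComposite f h L μ) (hθ0 : 0 ≤ θ) (hθ1 : θ ≤ 1)
    (u : EuclideanSpace ℝ (Fin n)) (k : ℕ) :
    potentialBase f h θ μ u y z w k + ∑ a, potentialGain f h θ μ u (z k) (w k) a ≤
      (1 - θ) * potential f h θ μ u x z k := by
  have hx := mul_le_mul_of_nonneg_left (hc.convex (w k) (x k)) (sub_nonneg.2 hθ1)
  have hu := mul_le_mul_of_nonneg_left (hc.convex (w k) u) hθ0
  have hgain : ∑ a, potentialGain f h θ μ u (z k) (w k) a =
      θ * (sepSum h u - sepSum h (z k) + ∑ a, gradient f (w k) a * (u a - z k a))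
        - θ * μ / 2 * ‖z k - u‖ ^ 2 := by
    simp only [potentialGain, sepSum, Finset.sum_sub_distrib, Finset.sum_add_distrib,
      ← Finset.mul_sum, EuclideanSpace.real_norm_sq_eq, PiLp.sub_apply]
    congr 2
    exact Finset.sum_congr rfl fun a _ => by ring
  -- As `y = (1 - θ) x + θ z`, replacing `θ z` by `θ u` turns `y - w` into `(1 - θ) (x - w) + θ (u -
  -- w)`; the tangent inequality at `w k` then applies at `x k` and at `u`.
  have hlin : ∑ l, gradient f (w k) l * (y k l - w k l)
      + θ * ∑ a, gradient f (w k) a * (u a - z k a) =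
      (1 - θ) * ∑ l, gradient f (w k) l * (x k l - w k l)
        + θ * ∑ l, gradient f (w k) l * (u l - w k l) := by
    simp only [Finset.mul_sum, ← Finset.sum_add_distrib]
    refine Finset.sum_congr rfl fun l _ => ?_
    have := congrArg (fun v : EuclideanSpace ℝ (Fin n) => v l) (hr.y_eq k)
    simp only [PiLp.add_apply, PiLp.smul_apply, smul_eq_mul] at this
    rw [this]
    ring
  rw [hgain]
  unfold potentialBase potential
  linarith

theorem potential_succ_le (hr : IsAASCDRun f h γ θ i j x y z w) (hc : IsCoordComposite f h L μ)
    (hL : 0 ≤ L) (hθ0 : 0 ≤ θ) (hθ1 : θ ≤ 1) (hnθ : n * θ ≤ 1)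
    (hθγ : (n * θ) ^ 2 / γ + n * θ * μ = μ) {τ : ℕ} (hτ : τ ≤ n)
    {u : EuclideanSpace ℝ (Fin n)} (hu : u ∈ sepDom h) {k : ℕ} (hj : j k ≤ k)
    (hjτ : k ≤ j k + τ) :
    potential f h θ μ u x z (k + 1) ≤
      potentialBase f h θ μ u y z w k + n * potentialGain f h θ μ u (z k) (w k) (i k)
      + 2 * L * (n * θ) ^ 2 * (τ + 1) *
          ∑ s ∈ Finset.Ico (k - τ) (k + 1), (z (s + 1) (i s) - z s (i s)) ^ 2
      - (n * θ) ^ 2 / (2 * γ) * (z (k + 1) (i k) - z k (i k)) ^ 2 := by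
  have hn0 : 0 ≤ n * θ := by positivity
  have hprox := (prox_add_sq_le (hc.ne_bot _) (hc.strong _) (hr.isMinOn_step k)
    (hr.z_mem_sepDom hc k _)).2 (u (i k)) (hu _)
  rw [add_sub_cancel] at hprox
  have hprox' := mul_le_mul_of_nonneg_left hprox hn0
  have hnorm : ‖z (k + 1) - u‖ ^ 2 = ‖z k - u‖ ^ 2
      + ((z (k + 1) (i k) - u (i k)) ^ 2 - (z k (i k) - u (i k)) ^ 2) := by
    simp only [EuclideanSpace.real_norm_sq_eq, PiLp.sub_apply]
    exact Finset.sum_eq_sum_add_sub_of_forall_ne (i k) fun l hl => by rw [hr.z_rest k l hl]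
  have hsep : sepSum h (z (k + 1)) = sepSum h (z k)
      + ((h (i k) (z (k + 1) (i k))).toReal - (h (i k) (z k (i k))).toReal) :=
    Finset.sum_eq_sum_add_sub_of_forall_ne (i k) fun l hl => by rw [hr.z_rest k l hl]
  have hxs : ∑ l, gradient f (w k) l * (x (k + 1) l - w k l) =
      ∑ l, gradient f (w k) l * (y k l - w k l)
        + n * θ * (gradient f (w k) (i k) * (z (k + 1) (i k) - z k (i k))) := by
    have hxk := hr.x_succ_eq k
    rw [Finset.sum_eq_sum_add_sub_of_forall_ne (i k)
      (G := fun l => gradient f (w k) l * (y k l - w k l))]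
    · simp only [hxk, PiLp.add_apply, PiLp.sub_apply, PiLp.smul_apply, smul_eq_mul]
      ring
    · intro l hl
      simp [hxk, hr.z_rest k l hl]
  have hsmooth := hc.smooth (w k) (x (k + 1))
  have herr : L / 2 * (∑ l, |x (k + 1) l - w k l|) ^ 2 ≤ 2 * L * (n * θ) ^ 2 * (τ + 1) *
      ∑ s ∈ Finset.Ico (k - τ) (k + 1), (z (s + 1) (i s) - z s (i s)) ^ 2 := by
    have h1 := hr.sum_abs_x_succ_sub_w_le hθ0 hθ1 hnθ hτ hj hjτ
    have h2 : (∑ s ∈ Finset.Ico (k - τ) (k + 1), |z (s + 1) (i s) - z s (i s)|) ^ 2 ≤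
        (τ + 1) * ∑ s ∈ Finset.Ico (k - τ) (k + 1), (z (s + 1) (i s) - z s (i s)) ^ 2 := by
      refine (sq_sum_le_card_mul_sum_sq).trans ?_
      simp only [sq_abs, Nat.card_Ico]
      gcongr
      exact_mod_cast (by omega : k + 1 - (k - τ) ≤ τ + 1)
    calc L / 2 * (∑ l, |x (k + 1) l - w k l|) ^ 2
        ≤ L / 2 * (2 * (n * θ) *
          ∑ s ∈ Finset.Ico (k - τ) (k + 1), |z (s + 1) (i s) - z s (i s)|) ^ 2 := by
          gcongr
      _ = 2 * L * (n * θ) ^ 2 *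
          (∑ s ∈ Finset.Ico (k - τ) (k + 1), |z (s + 1) (i s) - z s (i s)|) ^ 2 := by ring
      _ ≤ 2 * L * (n * θ) ^ 2 * ((τ + 1) *
          ∑ s ∈ Finset.Ico (k - τ) (k + 1), (z (s + 1) (i s) - z s (i s)) ^ 2) := by gcongr
      _ = _ := by ring
  -- The defining equation of `θ` enters here. After scaling the proximal inequality by `n * θ`, the
  -- new distance to `u` has weight exactly `μ / 2`, as in the potential, and the old one falls
  -- short of it by `n * θ * μ / 2`, the source of the contraction.
  have hγ2 : (n * θ) ^ 2 / (2 * γ) = (μ - n * θ * μ) / 2 := by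
    rw [show μ - n * θ * μ = (n * θ) ^ 2 / γ by linarith]
    ring
  have hκ : ∀ t, n * θ * (n * θ / (2 * γ) * t) = (μ - n * θ * μ) / 2 * t := fun t => by
    rw [← hγ2]
    ring
  have hκ' : ∀ t, n * θ * ((μ / 2 + n * θ / (2 * γ)) * t) = μ / 2 * t := fun t => by
    rw [add_mul, mul_add, hκ]
    ring
  have e1 : n * θ * ((h (i k) (z (k + 1) (i k))).toReal
      + gradient f (w k) (i k) * (z (k + 1) (i k) - z k (i k))
      + n * θ / (2 * γ) * (z (k + 1) (i k) - z k (i k)) ^ 2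
      + (μ / 2 + n * θ / (2 * γ)) * (u (i k) - z (k + 1) (i k)) ^ 2) =
      n * θ * ((h (i k) (z (k + 1) (i k))).toReal
      + gradient f (w k) (i k) * (z (k + 1) (i k) - z k (i k)))
      + (μ - n * θ * μ) / 2 * (z (k + 1) (i k) - z k (i k)) ^ 2
      + μ / 2 * (u (i k) - z (k + 1) (i k)) ^ 2 := by
    rw [mul_add, mul_add, hκ, hκ']
  have e2 : n * θ * ((h (i k) (u (i k))).toReal + gradient f (w k) (i k) * (u (i k) - z k (i k))
      + n * θ / (2 * γ) * (u (i k) - z k (i k)) ^ 2) =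
      n * θ * ((h (i k) (u (i k))).toReal + gradient f (w k) (i k) * (u (i k) - z k (i k)))
      + (μ - n * θ * μ) / 2 * (u (i k) - z k (i k)) ^ 2 := by
    rw [mul_add, hκ]
  rw [e1, e2] at hprox'
  rw [hxs] at hsmooth
  unfold potential potentialBase potentialGain
  rw [hnorm, hsep, hγ2, expAvg, smul_eq_mul, smul_eq_mul]
  linarith

/-- The state of a run is determined by the coordinates and read times used so far. -/
theorem state_congr {i' : ℕ → Fin n} {j' : ℕ → ℕ} {x' y' z' w' : ℕ → EuclideanSpace ℝ (Fin n)}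
    (hr : IsAASCDRun f h γ θ i j x y z w) (hr' : IsAASCDRun f h γ θ i' j' x' y' z' w')
    (hc : IsCoordComposite f h L μ) (hμ : 0 ≤ μ) (hκ : 0 < n * θ / (2 * γ))
    (hj : ∀ k, j k ≤ k) (k : ℕ) (hi' : ∀ s < k, i s = i' s) (hj' : ∀ s < k, j s = j' s) :
    ∀ s ≤ k, x s = x' s ∧ z s = z' s := by
  induction k with
  | zero =>
    intro s hs
    obtain rfl : s = 0 := by omega
    simp [hr.x_zero, hr'.x_zero, hr.z_zero, hr'.z_zero]
  | succ k ih =>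
    have ih := ih (fun s hs => hi' s (by omega)) fun s hs => hj' s (by omega)
    have hw : w k = w' k := by
      rw [hr.w_eq, hr'.w_eq, ← hj' k (by omega), hr.y_eq, hr'.y_eq, (ih _ (hj k)).1,
        (ih _ (hj k)).2]
    have hz : z (k + 1) = z' (k + 1) := by
      ext l
      by_cases hl : l = i k
      · have h1 := hr.isMinOn_step k
        have h2 := hr'.isMinOn_step k
        rw [← hw, ← hi' k (by omega), ← (ih k le_rfl).2] at h2
        have := prox_unique hμ hκ (hc.ne_bot _) (hc.strong _) h1 h2 (hr.z_mem_sepDom hc k _)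
        rw [hl]
        linarith
      · rw [hr.z_rest k l hl, hr'.z_rest k l (by rwa [← hi' k (by omega)]), (ih k le_rfl).2]
    intro s hs
    rcases Nat.lt_or_eq_of_le hs with h | rfl
    · exact ih s (by omega)
    · exact ⟨by rw [hr.x_step, hr'.x_step, hz, (ih k le_rfl).1, (ih k le_rfl).2], hz⟩

theorem w_congr {i' : ℕ → Fin n} {j' : ℕ → ℕ} {x' y' z' w' : ℕ → EuclideanSpace ℝ (Fin n)}
    (hr : IsAASCDRun f h γ θ i j x y z w) (hr' : IsAASCDRun f h γ θ i' j' x' y' z' w')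
    {k : ℕ} (hj : j k ≤ k) (hj' : j k = j' k) (hs : ∀ s ≤ k, x s = x' s ∧ z s = z' s) :
    w k = w' k := by
  rw [hr.w_eq, hr'.w_eq, ← hj', hr.y_eq, hr'.y_eq, (hs _ hj).1, (hs _ hj).2]

end IsAASCDRun

theorem expAvg_congr {V : Type*} [AddCommGroup V] [Module ℝ V] {θ : ℝ} {a b : ℕ → V} {k : ℕ}
    (h : ∀ s ≤ k, a s = b s) : expAvg θ a k = expAvg θ b k := by
  induction k with
  | zero => exact h 0 le_rfl
  | succ k ih => rw [expAvg, expAvg, ih fun s hs => h s (by omega), h k (by omega)]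

/-! ### Absorbing delayed errors -/

/-- Linear decay in the presence of delayed error terms dominated by a descent term. -/
theorem le_pow_mul_of_delayed_descent {v D : ℕ → ℝ} {ρ a B : ℝ} {τ : ℕ} (hρ0 : 0 < ρ)
    (hρ1 : ρ ≤ 1) (hB : 0 ≤ B) (hD : ∀ k, 0 ≤ D k) (hab : B * (τ + 1) ≤ a * ρ ^ τ)
    (hv : ∀ k, v (k + 1) ≤ ρ * v k + B * ∑ s ∈ Finset.Ico (k - τ) (k + 1), D s - a * D k)
    (K : ℕ) : v K ≤ ρ ^ K * v 0 := by
  -- After division by `ρ ^ K`, each `D s` is charged as an error only at the `τ + 1` times `s, …, s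
  -- + τ`, each charge inflated by at most `ρ ^ (-τ)`. The minimum counts the charges made before
  -- time `K`.
  have key : ∀ K, v K / ρ ^ K + ∑ s ∈ Finset.range K,
      (a - B / ρ ^ τ * (min (K - s) (τ + 1) : ℕ)) * (D s / ρ ^ (s + 1)) ≤ v 0 := by
    intro K
    induction K with
    | zero => simp
    | succ k ih =>
      have h1 : v (k + 1) / ρ ^ (k + 1) ≤ v k / ρ ^ k
          + B / ρ ^ τ * ∑ s ∈ Finset.Ico (k - τ) (k + 1), D s / ρ ^ (s + 1)
          - a * (D k / ρ ^ (k + 1)) := by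
        have h2 : B * ∑ s ∈ Finset.Ico (k - τ) (k + 1), D s ≤
            ρ ^ (k + 1) * (B / ρ ^ τ *
              ∑ s ∈ Finset.Ico (k - τ) (k + 1), D s / ρ ^ (s + 1)) := by
          rw [mul_left_comm, ← mul_assoc, div_mul_eq_mul_div,
            mul_comm (B * ρ ^ (k + 1) / ρ ^ τ), Finset.sum_mul, Finset.mul_sum]
          refine Finset.sum_le_sum fun s hs => ?_
          rw [Finset.mem_Ico] at hs
          have h3 : ρ ^ (s + 1 + τ) ≤ ρ ^ (k + 1) :=
            pow_le_pow_of_le_one hρ0.le hρ1 (by omega)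
          have h4 : D s / ρ ^ (s + 1) * (B * ρ ^ (k + 1) / ρ ^ τ) =
            B * D s * (ρ ^ (k + 1) / ρ ^ (s + 1 + τ)) := by
            rw [pow_add ρ (s + 1) τ]
            field_simp
          rw [h4]
          exact le_mul_of_one_le_right (mul_nonneg hB (hD s))
            ((one_le_div (by positivity)).2 h3)
        rw [div_le_iff₀ (by positivity)]
        refine (hv k).trans ?_
        have h5 : (v k / ρ ^ k + B / ρ ^ τ * ∑ s ∈ Finset.Ico (k - τ) (k + 1), D s / ρ ^ (s + 1)
          - a * (D k / ρ ^ (k + 1))) * ρ ^ (k + 1) = ρ * v k + ρ ^ (k + 1) * (B / ρ ^ τ *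
              ∑ s ∈ Finset.Ico (k - τ) (k + 1), D s / ρ ^ (s + 1)) - a * D k := by
          have h6 : v k / ρ ^ k * ρ ^ (k + 1) = ρ * v k := by
            rw [pow_succ]
            field_simp
          rw [sub_mul, add_mul, mul_assoc a, div_mul_cancel₀ _ (by positivity), h6]
          ring
        linarith
      have h6 : ∑ s ∈ Finset.range (k + 1),
          (a - B / ρ ^ τ * (min (k + 1 - s) (τ + 1) : ℕ)) * (D s / ρ ^ (s + 1)) =
          ∑ s ∈ Finset.range k, (a - B / ρ ^ τ * (min (k - s) (τ + 1) : ℕ)) * (D s / ρ ^ (s + 1))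
          + a * (D k / ρ ^ (k + 1))
          - B / ρ ^ τ * ∑ s ∈ Finset.Ico (k - τ) (k + 1), D s / ρ ^ (s + 1) := by
        have h7 : ∑ s ∈ Finset.Ico (k - τ) (k + 1), D s / ρ ^ (s + 1) =
            ∑ s ∈ Finset.range (k + 1), if k ≤ s + τ then D s / ρ ^ (s + 1) else 0 := by
          rw [← Finset.sum_filter]
          refine Finset.sum_congr ?_ fun _ _ => rfl
          ext s
          simp only [Finset.mem_Ico, Finset.mem_filter, Finset.mem_range]
          omega
        have h8 : a * (D k / ρ ^ (k + 1)) = (a - B / ρ ^ τ * (min (k - k) (τ + 1) : ℕ))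
            * (D k / ρ ^ (k + 1)) := by simp
        rw [h7, h8, ← Finset.sum_range_succ (fun s =>
          (a - B / ρ ^ τ * (min (k - s) (τ + 1) : ℕ)) * (D s / ρ ^ (s + 1))), Finset.mul_sum,
          ← Finset.sum_sub_distrib]
        refine Finset.sum_congr rfl fun s hs => ?_
        rw [Finset.mem_range] at hs
        split_ifs with hks
        · have : min (k + 1 - s) (τ + 1) = min (k - s) (τ + 1) + 1 := by omega
          rw [this]
          push_cast
          ring
        · have : min (k + 1 - s) (τ + 1) = min (k - s) (τ + 1) := by omega
          rw [this]
          ring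
      linarith
  have hsum : 0 ≤ ∑ s ∈ Finset.range K,
      (a - B / ρ ^ τ * (min (K - s) (τ + 1) : ℕ)) * (D s / ρ ^ (s + 1)) := by
    refine Finset.sum_nonneg fun s _ => mul_nonneg (sub_nonneg.2 ?_) (div_nonneg (hD s) (by positivity))
    have h1 : ((min (K - s) (τ + 1) : ℕ) : ℝ) ≤ τ + 1 := by exact_mod_cast min_le_right _ _
    calc B / ρ ^ τ * (min (K - s) (τ + 1) : ℕ) ≤ B / ρ ^ τ * (τ + 1) := by gcongr
      _ = B * (τ + 1) / ρ ^ τ := by ring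
      _ ≤ a := by rwa [div_le_iff₀ (by positivity)]
  have := key K
  rw [← div_le_iff₀' (by positivity)]
  linarith

/-! ### Finite histories and averaging over the random coordinate -/

theorem integrable_comp_of_finite {Ω T : Type*} [MeasurableSpace Ω] {P : Measure Ω}
    [IsFiniteMeasure P] [Finite T] [MeasurableSpace T] [MeasurableSingletonClass T] {H : Ω → T}
    (hH : Measurable H) (Φ : T → ℝ) : Integrable (fun ω => Φ (H ω)) P := by
  have := Fintype.ofFinite T
  refine Integrable.of_bound ((measurable_of_finite Φ).comp hH).aestronglyMeasurable
    (∑ t, ‖Φ t‖) (ae_of_all _ fun ω => ?_)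
  exact Finset.single_le_sum (f := fun t => ‖Φ t‖) (fun _ _ => norm_nonneg _)
    (Finset.mem_univ (H ω))

theorem integral_add_add_mul_sub_mul {Ω : Type*} [MeasurableSpace Ω] {P : Measure Ω}
    {A G S D : Ω → ℝ} {a b : ℝ} (hA : Integrable A P) (hG : Integrable G P)
    (hS : Integrable S P) (hD : Integrable D P) :
    ∫ ω, (A ω + G ω + b * S ω - a * D ω) ∂P =
      ∫ ω, A ω ∂P + ∫ ω, G ω ∂P + b * ∫ ω, S ω ∂P - a * ∫ ω, D ω ∂P := by
  have h1 : Integrable (fun ω => A ω + G ω) P := hA.add hG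
  have h2 : Integrable (fun ω => A ω + G ω + b * S ω) P := h1.add (hS.const_mul b)
  rw [integral_sub h2 (hD.const_mul a), integral_add h1 (hS.const_mul b), integral_add hA hG,
    integral_const_mul, integral_const_mul]

namespace IsSchedule

variable {Ω : Type*} [mΩ : MeasurableSpace Ω] {n : ℕ} {P : Measure Ω}
  {ℱ : Filtration ℕ mΩ} {τ : ℕ} {i : ℕ → Ω → Fin n} {j : ℕ → Ω → ℕ}

/-- Averaging over the uniformly chosen coordinate, given the past. -/
theorem integral_index [IsProbabilityMeasure P] (hS : IsSchedule P ℱ τ i j) (k : ℕ) {T : Type*}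
    [Finite T] [MeasurableSpace T] [MeasurableSingletonClass T] {H : Ω → T}
    (hH : Measurable[ℱ k] H) (G : T → Fin n → ℝ) :
    ∫ ω, n * G (H ω) (i k ω) ∂P = ∫ ω, ∑ a, G (H ω) a ∂P := by
  have hn : (n : ℝ) ≠ 0 := by
    obtain ⟨ω⟩ := nonempty_of_isProbabilityMeasure P
    exact Nat.cast_ne_zero.2 (Fin.pos (i k ω)).ne'
  have hH' : Measurable H := hH.mono (ℱ.le k) le_rfl
  have hi : Measurable (i k) := (hS.index_meas k).mono (ℱ.le _) le_rfl
  have hsplit : ∀ ω, n * G (H ω) (i k ω) =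
      ∑ a, n * ((if i k ω = a then 1 else 0) * G (H ω) a) := fun ω => by
    rw [← Finset.mul_sum]
    simp
  simp only [hsplit]
  have hint : ∀ a, Integrable (fun ω => n * ((if i k ω = a then 1 else 0) * G (H ω) a)) P :=
    fun a => integrable_comp_of_finite (hi.prodMk hH')
      (fun b : Fin n × T => (n : ℝ) * ((if b.1 = a then 1 else 0) * G b.2 a))
  rw [integral_finsetSum _ fun a _ => hint a,
    integral_finsetSum _ fun a _ => integrable_comp_of_finite hH' fun t => G t a]
  refine Finset.sum_congr rfl fun a _ => ?_
  have hindep : IndepFun (fun ω => if i k ω = a then (1 : ℝ) else 0) (fun ω => G (H ω) a) P := by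
    rw [IndepFun_iff_Indep]
    refine indep_of_indep_of_le (hS.index_indep k) ?_ ?_
    · refine Measurable.comap_le ?_
      exact (measurable_of_finite fun b : Fin n => if b = a then (1 : ℝ) else 0).comp
        (comap_measurable (i k))
    · exact Measurable.comap_le ((measurable_of_finite fun t => G t a).comp hH)
  have hset : MeasurableSet {ω | i k ω = a} := hi (measurableSet_singleton a)
  have hmean : ∫ ω, (if i k ω = a then (1 : ℝ) else 0) ∂P = (n : ℝ)⁻¹ := by
    have : (fun ω => if i k ω = a then (1 : ℝ) else 0) = {ω | i k ω = a}.indicator 1 := by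
      ext ω
      simp [Set.indicator_apply]
    rw [this, integral_indicator_one hset, measureReal_def, hS.index_uniform k a]
    simp
  rw [integral_const_mul, hindep.integral_fun_mul_eq_mul_integral
    (integrable_comp_of_finite hi fun b => if b = a then (1 : ℝ) else 0).aestronglyMeasurable
    (integrable_comp_of_finite hH' fun t => G t a).aestronglyMeasurable, hmean,
    mul_inv_cancel_left₀ hn]

end IsSchedule

/-- The coordinates chosen before iteration `k` and the read times up to iteration `k`. -/
def history {Ω : Type*} {n : ℕ} (i : ℕ → Ω → Fin n) (j : ℕ → Ω → ℕ) (k : ℕ) (ω : Ω) :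
    (Fin k → Fin n) × (Fin (k + 1) → Fin (k + 1)) :=
  (fun s => i s ω, fun s => Fin.ofNat (k + 1) (j s ω))

theorem history_eq_iff {Ω : Type*} {n : ℕ} {i : ℕ → Ω → Fin n} {j : ℕ → Ω → ℕ}
    (hj : ∀ k ω, j k ω ≤ k) {k : ℕ} {ω ω' : Ω} :
    history i j k ω = history i j k ω' ↔
      (∀ s < k, i s ω = i s ω') ∧ ∀ s ≤ k, j s ω = j s ω' := by
  simp only [history, Prod.mk.injEq, funext_iff, Fin.forall_iff, Nat.lt_succ_iff, Fin.ext_iff,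
    Fin.val_ofNat]
  refine and_congr_right fun _ => forall₂_congr fun s hs => ?_
  rw [Nat.mod_eq_of_lt (Nat.lt_succ_of_le ((hj s ω).trans hs)),
    Nat.mod_eq_of_lt (Nat.lt_succ_of_le ((hj s ω').trans hs))]

theorem measurable_history_of {Ω : Type*} [MeasurableSpace Ω] {n : ℕ} {i : ℕ → Ω → Fin n}
    {j : ℕ → Ω → ℕ} {k : ℕ} (hi : ∀ s < k, Measurable (i s)) (hj : ∀ s ≤ k, Measurable (j s)) :
    Measurable (history i j k) :=
  Measurable.prodMk (measurable_pi_lambda _ fun s : Fin k => hi s s.2)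
    (measurable_pi_lambda _ fun s : Fin (k + 1) =>
      (measurable_from_nat (f := fun m => Fin.ofNat (k + 1) m)).comp (hj s (Nat.lt_succ_iff.1 s.2)))

theorem IsSchedule.measurable_history {Ω : Type*} [mΩ : MeasurableSpace Ω] {n : ℕ} {P : Measure Ω}
    {ℱ : Filtration ℕ mΩ} {τ : ℕ} {i : ℕ → Ω → Fin n} {j : ℕ → Ω → ℕ}
    (hS : IsSchedule P ℱ τ i j) (k : ℕ) : Measurable[ℱ k] (history i j k) :=
  @measurable_history_of Ω (ℱ k) n i j k
    (fun s hs => (hS.index_meas s).mono (ℱ.mono (Nat.succ_le_of_lt hs)) le_rfl)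
    fun s hs => (hS.read_meas s).mono (ℱ.mono hs) le_rfl

/-! ### Convergence in expectation -/

section Convergence

variable {n : ℕ} {f : EuclideanSpace ℝ (Fin n) → ℝ} {h : Fin n → ℝ → EReal} {γ θ L μ : ℝ}

theorem potential_eq_of_state_eq {u : EuclideanSpace ℝ (Fin n)}
    {x x' z z' : ℕ → EuclideanSpace ℝ (Fin n)} {k : ℕ}
    (hs : ∀ s ≤ k, x s = x' s ∧ z s = z' s) :
    potential f h θ μ u x z k = potential f h θ μ u x' z' k := by
  unfold potential
  rw [(hs k le_rfl).1, (hs k le_rfl).2,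
    expAvg_congr (b := fun s => sepSum h (z' s)) fun s hsk => by rw [(hs s hsk).2]]

theorem potentialBase_eq_of_state_eq {u : EuclideanSpace ℝ (Fin n)}
    {y y' z z' w w' : ℕ → EuclideanSpace ℝ (Fin n)} {k : ℕ}
    (hs : ∀ s ≤ k, z s = z' s) (hy : y k = y' k) (hw : w k = w' k) :
    potentialBase f h θ μ u y z w k = potentialBase f h θ μ u y' z' w' k := by
  unfold potentialBase
  rw [hs k le_rfl, hy, hw,
    expAvg_congr (b := fun s => sepSum h (z' s)) fun s hsk => by rw [hs s hsk]]

variable {Ω : Type*} {i : ℕ → Ω → Fin n} {j : ℕ → Ω → ℕ}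
  {x y z w : ℕ → Ω → EuclideanSpace ℝ (Fin n)}

/-- Uniqueness of the proximal step makes the state a function of a finitely valued history.
Measurability and integrability of everything built from it follow, although the run itself is only
assumed pathwise. -/
theorem state_eq_of_history_eq
    (hr : ∀ ω, IsAASCDRun f h γ θ (fun k => i k ω) (fun k => j k ω) (fun k => x k ω)
      (fun k => y k ω) (fun k => z k ω) (fun k => w k ω))
    (hc : IsCoordComposite f h L μ) (hμ : 0 ≤ μ) (hκ : 0 < n * θ / (2 * γ))
    (hj : ∀ k ω, j k ω ≤ k) {k : ℕ} {ω ω' : Ω} (hω : history i j k ω = history i j k ω') :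
    (∀ s ≤ k, x s ω = x s ω' ∧ z s ω = z s ω') ∧ y k ω = y k ω' ∧ w k ω = w k ω' := by
  obtain ⟨h1, h2⟩ := (history_eq_iff hj).1 hω
  have h3 := (hr ω).state_congr (hr ω') hc hμ hκ (fun k => hj k ω) k h1 fun s hs => h2 s hs.le
  refine ⟨h3, ?_, (hr ω).w_congr (hr ω') (hj k ω) (h2 k le_rfl) h3⟩
  rw [(hr ω).y_eq, (hr ω').y_eq, (h3 k le_rfl).1, (h3 k le_rfl).2]

variable [mΩ : MeasurableSpace Ω] {P : Measure Ω} [IsProbabilityMeasure P]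
  {ℱ : Filtration ℕ mΩ} {τ : ℕ}

/-- A function of the history is integrable. -/
theorem IsSchedule.integrable_of_history (hS : IsSchedule P ℱ τ i j) (k : ℕ) {X : Ω → ℝ}
    (hX : ∀ ω ω', history i j k ω = history i j k ω' → X ω = X ω') : Integrable X P := by
  obtain ⟨Φ, rfl⟩ := (Function.factorsThrough_iff X).1 (fun ω ω' => hX ω ω')
  exact integrable_comp_of_finite ((hS.measurable_history k).mono (ℱ.le k) le_rfl) Φ

theorem integrable_iterate (hS : IsSchedule P ℱ τ i j)
    (hr : ∀ ω, IsAASCDRun f h γ θ (fun k => i k ω) (fun k => j k ω) (fun k => x k ω)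
      (fun k => y k ω) (fun k => z k ω) (fun k => w k ω))
    (hc : IsCoordComposite f h L μ) (hμ : 0 ≤ μ) (hκ : 0 < n * θ / (2 * γ))
    (φ : EuclideanSpace ℝ (Fin n) → ℝ) (k : ℕ) :
    Integrable (fun ω => φ (x k ω)) P :=
  hS.integrable_of_history k fun ω ω' hω => by
    rw [((state_eq_of_history_eq hr hc hμ hκ hS.read_le hω).1 k le_rfl).1]

theorem integrable_potential (hS : IsSchedule P ℱ τ i j)
    (hr : ∀ ω, IsAASCDRun f h γ θ (fun k => i k ω) (fun k => j k ω) (fun k => x k ω)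
      (fun k => y k ω) (fun k => z k ω) (fun k => w k ω))
    (hc : IsCoordComposite f h L μ) (hμ : 0 ≤ μ) (hκ : 0 < n * θ / (2 * γ))
    (u : EuclideanSpace ℝ (Fin n)) (k : ℕ) :
    Integrable (fun ω => potential f h θ μ u (fun k => x k ω) (fun k => z k ω) k) P :=
  hS.integrable_of_history k fun _ _ hω =>
    potential_eq_of_state_eq (state_eq_of_history_eq hr hc hμ hκ hS.read_le hω).1

theorem integrable_sq_step (hS : IsSchedule P ℱ τ i j)
    (hr : ∀ ω, IsAASCDRun f h γ θ (fun k => i k ω) (fun k => j k ω) (fun k => x k ω)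
      (fun k => y k ω) (fun k => z k ω) (fun k => w k ω))
    (hc : IsCoordComposite f h L μ) (hμ : 0 ≤ μ) (hκ : 0 < n * θ / (2 * γ)) (s : ℕ) :
    Integrable (fun ω => (z (s + 1) ω (i s ω) - z s ω (i s ω)) ^ 2) P :=
  hS.integrable_of_history (s + 1) fun _ _ hω => by
    have h1 := (state_eq_of_history_eq hr hc hμ hκ hS.read_le hω).1
    rw [(h1 (s + 1) le_rfl).2, (h1 s (Nat.le_succ s)).2,
      ((history_eq_iff hS.read_le).1 hω).1 s (Nat.lt_succ_self s)]

theorem integral_potential_succ_le (hS : IsSchedule P ℱ τ i j)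
    (hr : ∀ ω, IsAASCDRun f h γ θ (fun k => i k ω) (fun k => j k ω) (fun k => x k ω)
      (fun k => y k ω) (fun k => z k ω) (fun k => w k ω))
    (hc : IsCoordComposite f h L μ) (hμ : 0 ≤ μ) (hL : 0 ≤ L) (hγ : 0 < γ) (hn : 0 < n)
    (hθ0 : 0 < θ) (hnθ : n * θ ≤ 1) (hθγ : (n * θ) ^ 2 / γ + n * θ * μ = μ) (hτ : τ ≤ n)
    {u : EuclideanSpace ℝ (Fin n)} (hu : u ∈ sepDom h) (k : ℕ) :
    ∫ ω, potential f h θ μ u (fun k => x k ω) (fun k => z k ω) (k + 1) ∂P ≤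
      (1 - θ) * ∫ ω, potential f h θ μ u (fun k => x k ω) (fun k => z k ω) k ∂P
      + 2 * L * (n * θ) ^ 2 * (τ + 1) * ∑ s ∈ Finset.Ico (k - τ) (k + 1),
          ∫ ω, (z (s + 1) ω (i s ω) - z s ω (i s ω)) ^ 2 ∂P
      - (n * θ) ^ 2 / (2 * γ) * ∫ ω, (z (k + 1) ω (i k ω) - z k ω (i k ω)) ^ 2 ∂P := by
  have hn' : (1 : ℝ) ≤ n := by exact_mod_cast hn
  have hθ1 : θ ≤ 1 := by nlinarith
  have hκ : 0 < n * θ / (2 * γ) := by positivity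
  have hstate {k : ℕ} {ω ω' : Ω} := state_eq_of_history_eq hr hc hμ hκ hS.read_le (k := k) (ω := ω)
    (ω' := ω')
  have hpot := integrable_potential hS hr hc hμ hκ u
  have hsq := integrable_sq_step hS hr hc hμ hκ
  have hbase : Integrable (fun ω => potentialBase f h θ μ u (fun k => y k ω) (fun k => z k ω)
      (fun k => w k ω) k) P := hS.integrable_of_history k fun ω ω' hω =>
    potentialBase_eq_of_state_eq (fun s hs => ((hstate hω).1 s hs).2) (hstate hω).2.1
      (hstate hω).2.2
  -- The history at time `k` contains the read time `j k` but not the coordinate `i k`. The gain is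
  -- factored through it with the coordinate left free, so that independence allows averaging.
  obtain ⟨G, hG⟩ : ∃ G, (fun ω => potentialGain f h θ μ u (z k ω) (w k ω)) = G ∘ history i j k := by
    refine (Function.factorsThrough_iff _).1 fun ω ω' hω => ?_
    simp only [((hstate hω).1 k le_rfl).2, (hstate hω).2.2]
  have hG' : ∀ ω, potentialGain f h θ μ u (z k ω) (w k ω) = G (history i j k ω) :=
    fun ω => congrFun hG ω
  have hgain := hS.integral_index k (hS.measurable_history k) G
  simp only [← hG'] at hgain
  have hgain_int : Integrable (fun ω => n * potentialGain f h θ μ u (z k ω) (w k ω) (i k ω)) P :=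
    hS.integrable_of_history (k + 1) fun ω ω' hω => by
      have h1 := (history_eq_iff hS.read_le).1 hω
      have h2 : history i j k ω = history i j k ω' := (history_eq_iff hS.read_le).2
        ⟨fun s hs => h1.1 s (by omega), fun s hs => h1.2 s (by omega)⟩
      rw [hG', hG', h2, h1.1 k (Nat.lt_succ_self k)]
  have hsum_int : Integrable (fun ω => ∑ a, potentialGain f h θ μ u (z k ω) (w k ω) a) P :=
    hS.integrable_of_history k fun ω ω' hω => by simp only [hG', hω]
  have hS_int : Integrable (fun ω => ∑ s ∈ Finset.Ico (k - τ) (k + 1),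
      (z (s + 1) ω (i s ω) - z s ω (i s ω)) ^ 2) P := integrable_finsetSum _ fun s _ => hsq s
  calc ∫ ω, potential f h θ μ u (fun k => x k ω) (fun k => z k ω) (k + 1) ∂P
      ≤ ∫ ω, (potentialBase f h θ μ u (fun k => y k ω) (fun k => z k ω) (fun k => w k ω) k
          + n * potentialGain f h θ μ u (z k ω) (w k ω) (i k ω)
          + 2 * L * (n * θ) ^ 2 * (τ + 1) * ∑ s ∈ Finset.Ico (k - τ) (k + 1),
              (z (s + 1) ω (i s ω) - z s ω (i s ω)) ^ 2
          - (n * θ) ^ 2 / (2 * γ) * (z (k + 1) ω (i k ω) - z k ω (i k ω)) ^ 2) ∂P :=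
        integral_mono (hpot (k + 1)) (((hbase.add hgain_int).add (hS_int.const_mul _)).sub
          ((hsq k).const_mul _)) fun ω => (hr ω).potential_succ_le hc hL hθ0.le hθ1 hnθ hθγ hτ hu
            (hS.read_le k ω) (hS.le_read k ω)
    _ = ∫ ω, (potentialBase f h θ μ u (fun k => y k ω) (fun k => z k ω) (fun k => w k ω) k
          + ∑ a, potentialGain f h θ μ u (z k ω) (w k ω) a) ∂P
        + 2 * L * (n * θ) ^ 2 * (τ + 1) * ∑ s ∈ Finset.Ico (k - τ) (k + 1),
          ∫ ω, (z (s + 1) ω (i s ω) - z s ω (i s ω)) ^ 2 ∂P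
        - (n * θ) ^ 2 / (2 * γ) * ∫ ω, (z (k + 1) ω (i k ω) - z k ω (i k ω)) ^ 2 ∂P := by
        rw [integral_add_add_mul_sub_mul hbase hgain_int hS_int (hsq k),
          integral_finsetSum _ fun s _ => hsq s, integral_add hbase hsum_int, hgain]
    _ ≤ _ := by
        gcongr
        rw [← integral_const_mul]
        exact integral_mono (hbase.add hsum_int) ((hpot k).const_mul _) fun ω =>
          (hr ω).potentialBase_add_sum_le hc hθ0.le hθ1 u k

/-- Linear convergence of AASCD in expectation, relative to an arbitrary reference point. -/
theorem integral_objective_sub_le (hS : IsSchedule P ℱ τ i j)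
    (hr : ∀ ω, IsAASCDRun f h γ θ (fun k => i k ω) (fun k => j k ω) (fun k => x k ω)
      (fun k => y k ω) (fun k => z k ω) (fun k => w k ω))
    (hc : IsCoordComposite f h L μ) (hμ : 0 ≤ μ) (hL : 0 ≤ L) (hγ : 0 < γ) (hn : 0 < n)
    (hθ0 : 0 < θ) (hnθ : n * θ ≤ 1 / 2) (hθγ : (n * θ) ^ 2 / γ + n * θ * μ = μ) (hτ : τ ≤ n)
    (hstep : 8 * L * (τ + 1) ^ 2 * γ ≤ 1)
    {u : EuclideanSpace ℝ (Fin n)} (hu : u ∈ sepDom h) (K : ℕ) :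
    ∫ ω, (f (x K ω) + sepSum h (x K ω)) ∂P - (f u + sepSum h u) ≤
      (1 - θ) ^ K * (f 0 + sepSum h 0 - (f u + sepSum h u) + μ / 2 * ‖u‖ ^ 2) := by
  have hn' : (1 : ℝ) ≤ n := by exact_mod_cast hn
  have hθ1 : θ ≤ 1 / 2 := by nlinarith
  have hκ : 0 < n * θ / (2 * γ) := by positivity
  -- Bernoulli's inequality with `τ * θ ≤ n * θ ≤ 1 / 2`: the inflation of delayed errors costs at
  -- most a factor `2`.
  have hpow : 1 / 2 ≤ (1 - θ) ^ τ := by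
    have h1 := one_add_mul_le_pow (a := -θ) (by linarith) τ
    have h2 : τ * θ ≤ n * θ := by gcongr
    rw [← sub_eq_add_neg] at h1
    linarith
  have hmain := le_pow_mul_of_delayed_descent
    (v := fun k => ∫ ω, potential f h θ μ u (fun k => x k ω) (fun k => z k ω) k ∂P)
    (D := fun s => ∫ ω, (z (s + 1) ω (i s ω) - z s ω (i s ω)) ^ 2 ∂P)
    (ρ := 1 - θ) (a := (n * θ) ^ 2 / (2 * γ)) (B := 2 * L * (n * θ) ^ 2 * (τ + 1)) (τ := τ)
    (by linarith) (by linarith) (by positivity) (fun k => integral_nonneg fun _ => sq_nonneg _)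
    (by
      have h1 : (n * θ) ^ 2 / (2 * γ) * (1 / 2) ≤ (n * θ) ^ 2 / (2 * γ) * (1 - θ) ^ τ := by gcongr
      refine le_trans ?_ h1
      rw [div_mul_eq_mul_div, le_div_iff₀ (by positivity)]
      have h2 := mul_le_mul_of_nonneg_left hstep (by positivity : 0 ≤ (n * θ) ^ 2 / 2)
      linarith)
    (integral_potential_succ_le hS hr hc hμ hL hγ hn hθ0 (by linarith) hθγ hτ hu) K
  have h0 : ∫ ω, potential f h θ μ u (fun k => x k ω) (fun k => z k ω) 0 ∂P =
      f 0 + sepSum h 0 - (f u + sepSum h u) + μ / 2 * ‖u‖ ^ 2 := by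
    have : ∀ ω, potential f h θ μ u (fun k => x k ω) (fun k => z k ω) 0 =
        f 0 + sepSum h 0 - (f u + sepSum h u) + μ / 2 * ‖u‖ ^ 2 := fun ω => by
      simp only [potential, expAvg, (hr ω).x_zero, (hr ω).z_zero, zero_sub, norm_neg]
      ring
    simp [this]
  rw [h0] at hmain
  refine le_trans ?_ hmain
  have hobj := integrable_iterate hS hr hc hμ hκ (fun v => f v + sepSum h v) K
  have hconst : f u + sepSum h u = ∫ _, (f u + sepSum h u) ∂P := by simp
  rw [hconst, ← integral_sub hobj (integrable_const _)]
  refine integral_mono (hobj.sub (integrable_const _))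
    (integrable_potential hS hr hc hμ hκ u K) fun ω => ?_
  have h1 := ((hr ω).x_mem_sepDom hc hμ hθ0.le (by linarith) (by linarith) K).2
  have h2 : 0 ≤ μ / 2 * ‖z K ω - u‖ ^ 2 := by positivity
  simp only [potential]
  linarith

/-- Linear convergence of AASCD in expectation, relative to the infimum of the objective. -/
theorem integral_objective_sub_inf_le (hS : IsSchedule P ℱ τ i j)
    (hr : ∀ ω, IsAASCDRun f h γ θ (fun k => i k ω) (fun k => j k ω) (fun k => x k ω)
      (fun k => y k ω) (fun k => z k ω) (fun k => w k ω))
    (hc : IsCoordComposite f h L μ) (hμ : 0 ≤ μ) (hL : 0 ≤ L) (hγ : 0 < γ) (hn : 0 < n)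
    (hθ0 : 0 < θ) (hnθ : n * θ ≤ 1 / 2) (hθγ : (n * θ) ^ 2 / γ + n * θ * μ = μ) (hτ : τ ≤ n)
    (hstep : 8 * L * (τ + 1) ^ 2 * γ ≤ 1) {m : ℝ} (hm : ∀ u ∈ sepDom h, m ≤ f u + sepSum h u)
    (hm' : ∀ η > 0, ∃ u ∈ sepDom h, f u + sepSum h u ≤ m + η) (K : ℕ) :
    ∫ ω, (f (x K ω) + sepSum h (x K ω)) ∂P - m ≤
      3 * ((1 - θ) ^ K * (f 0 + sepSum h 0 - m)) := by
  have hn' : (1 : ℝ) ≤ n := by exact_mod_cast hn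
  have hθ1 : θ ≤ 1 / 2 := by nlinarith
  have hρ : (1 - θ) ^ K ≤ 1 := pow_le_one₀ (by linarith) (by linarith)
  have hρ0 : 0 ≤ (1 - θ) ^ K := pow_nonneg (by linarith) K
  refine le_of_forall_pos_le_add fun η hη => ?_
  obtain ⟨u, hu, hum⟩ := hm' (η / 3) (by positivity)
  have h1 := integral_objective_sub_le hS hr hc hμ hL hγ hn hθ0 hnθ hθγ hτ hstep hu K
  obtain ⟨h2, h3⟩ := hc.midpoint_zero_le hu
  have h4 := hm _ h2
  have h5 := hm u hu
  -- The midpoint has value at least `m`, so `μ / 2 * ‖u‖ ^ 2` is at most twice the sum of the gaps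
  -- of `u` and `0`; this is the source of the factor `3`.
  have h6 : f 0 + sepSum h 0 - (f u + sepSum h u) + μ / 2 * ‖u‖ ^ 2 ≤
      3 * (f 0 + sepSum h 0 - m) + 2 * (η / 3) := by linarith
  have h7 := mul_le_mul_of_nonneg_left h6 hρ0
  have h8 : (1 - θ) ^ K * (2 * (η / 3)) ≤ 1 * (2 * (η / 3)) := by gcongr
  linarith

end Convergence

/-! ### The dual of regularized risk minimization -/

theorem EReal.sum_eq_top_of_eq_top {ι : Type*} [Fintype ι] {F : ι → EReal}
    (hbot : ∀ l, F l ≠ ⊥) {l : ι} (hl : F l = ⊤) : ∑ l, F l = ⊤ := by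
  classical
  rw [← Finset.add_sum_erase _ _ (Finset.mem_univ l), hl]
  refine EReal.top_add_of_ne_bot ?_
  exact Finset.sum_induction F (· ≠ ⊥) (fun _ _ ha hb => EReal.add_ne_bot_iff.2 ⟨ha, hb⟩)
    EReal.zero_ne_bot fun l _ => hbot l

namespace ERM

variable {n d : ℕ} {p : ERM n d} {L₂ R : ℝ}

theorem dualSep_eq (l : Fin n) (a : ℝ) : p.dualSep l a =
    ((1 / (n : ℝ) : ℝ) : EReal) * fenchelConj (p.φ l) (-a) := rfl

theorem one_div_card_pos (l : Fin n) : 0 < 1 / (n : ℝ) := by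
  have : 0 < n := l.pos
  positivity

theorem dualSep_eq_top_iff (l : Fin n) (a : ℝ) :
    p.dualSep l a = ⊤ ↔ fenchelConj (p.φ l) (-a) = ⊤ := by
  rw [dualSep_eq]
  refine ⟨fun h => ?_, fun h => by rw [h, EReal.coe_mul_top_of_pos (one_div_card_pos l)]⟩
  by_contra h'
  rw [← coe_toReal_fenchelConj h', ← EReal.coe_mul] at h
  exact EReal.coe_ne_top _ h

theorem dualSep_ne_bot (l : Fin n) (a : ℝ) : p.dualSep l a ≠ ⊥ := by
  by_cases h : fenchelConj (p.φ l) (-a) = ⊤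
  · rw [(dualSep_eq_top_iff l a).2 h]
    exact top_ne_bot
  · rw [dualSep_eq, ← coe_toReal_fenchelConj h, ← EReal.coe_mul]
    exact EReal.coe_ne_bot _

theorem toReal_dualSep (l : Fin n) (a : ℝ) :
    (p.dualSep l a).toReal = 1 / (n : ℝ) * (fenchelConj (p.φ l) (-a)).toReal := by
  rw [dualSep_eq, EReal.toReal_mul, EReal.toReal_coe]

theorem dualSep_zero_ne_top {l : Fin n} (hb : BddBelow (Set.range (p.φ l))) :
    p.dualSep l 0 ≠ ⊤ := by
  obtain ⟨m, hm⟩ := hb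
  rw [Ne, dualSep_eq_top_iff]
  refine ne_top_of_le_ne_top (EReal.coe_ne_top (-m)) (fenchelConj_le_coe_iff.2 fun u => ?_)
  have := hm (Set.mem_range_self u)
  simp only [neg_zero, inner_zero_left]
  linarith

theorem strongConvexOn_dualSep (hL₂ : 0 < L₂) {l : Fin n} (hs : IsLSmooth L₂ (p.φ l)) :
    StrongConvexOn {a | p.dualSep l a ≠ ⊤} (strongMod n L₂) fun a => (p.dualSep l a).toReal := by
  have hn := one_div_card_pos l
  have hconj := hs.strongConvexOn_toReal_fenchelConj hL₂
  have hmem : ∀ a, a ∈ {a | p.dualSep l a ≠ ⊤} ↔ -a ∈ {s | fenchelConj (p.φ l) s ≠ ⊤} :=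
    fun a => (dualSep_eq_top_iff l a).not
  have hneg : ∀ a b x y : ℝ, -(a • x + b • y) = a • (-x) + b • (-y) := fun a b x y => by
    simp only [smul_eq_mul]; ring
  refine ⟨fun x hx y hy a b ha hb hab => ?_, fun x hx y hy a b ha hb hab => ?_⟩
  · rw [hmem, hneg]
    exact hconj.1 ((hmem x).1 hx) ((hmem y).1 hy) ha hb hab
  · have := mul_le_mul_of_nonneg_left
      (hconj.2 ((hmem x).1 hx) ((hmem y).1 hy) ha hb hab) hn.le
    rw [← hneg] at this
    simp only [toReal_dualSep]
    refine this.trans_eq ?_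
    rw [show -x - -y = -(x - y) by ring, norm_neg, strongMod]
    simp only [smul_eq_mul]
    ring

theorem dualMap_sub (a b : EuclideanSpace ℝ (Fin n)) :
    p.dualMap b - p.dualMap a = (1 / (p.lam * n)) • ∑ l, (b l - a l) • p.A l := by
  simp only [dualMap, ← smul_sub, ← Finset.sum_sub_distrib, sub_smul]

theorem inner_dualMap_sub (hlam : 0 < p.lam) (a b : EuclideanSpace ℝ (Fin n))
    (x : EuclideanSpace ℝ (Fin d)) : p.lam * inner ℝ (p.dualMap b - p.dualMap a) x =
      ∑ l, 1 / (n : ℝ) * inner ℝ (p.A l) x * (b l - a l) := by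
  rw [dualMap_sub, real_inner_smul_left, sum_inner, Finset.mul_sum, Finset.mul_sum]
  refine Finset.sum_congr rfl fun l _ => ?_
  rw [real_inner_smul_left]
  field_simp

/-- The triangle inequality with `‖p.A l‖ ≤ R` bounds the image by the ℓ¹ norm, so the coordinate
Lipschitz constant serves for moves in several coordinates. -/
theorem norm_dualMap_sub_le (hlam : 0 < p.lam) (hA : ∀ l, ‖p.A l‖ ≤ R)
    (a b : EuclideanSpace ℝ (Fin n)) :
    p.lam * (1 / 2 * ‖p.dualMap b - p.dualMap a‖ ^ 2) ≤
      coordLip n R p.lam / 2 * (∑ l, |b l - a l|) ^ 2 := by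
  have h1 : ‖∑ l, (b l - a l) • p.A l‖ ≤ R * ∑ l, |b l - a l| := by
    refine (norm_sum_le _ _).trans ?_
    rw [Finset.mul_sum]
    refine Finset.sum_le_sum fun l _ => ?_
    rw [norm_smul, Real.norm_eq_abs, mul_comm]
    exact mul_le_mul_of_nonneg_right (hA l) (abs_nonneg _)
  rw [dualMap_sub, norm_smul, Real.norm_of_nonneg (by positivity), mul_pow]
  calc p.lam * (1 / 2 * ((1 / (p.lam * n)) ^ 2 * ‖∑ l, (b l - a l) • p.A l‖ ^ 2))
      ≤ p.lam * (1 / 2 * ((1 / (p.lam * n)) ^ 2 * (R * ∑ l, |b l - a l|) ^ 2)) := by gcongr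
    _ = coordLip n R p.lam / 2 * (∑ l, |b l - a l|) ^ 2 := by
      rw [coordLip]
      field_simp

/-- Values, linearization and smoothness of the smooth part of the dual. -/
theorem dualSmooth_bounds (hlam : 0 < p.lam) (hg : StrongConvexOn Set.univ 1 p.g)
    (hA : ∀ l, ‖p.A l‖ ≤ R) (a : EuclideanSpace ℝ (Fin n)) :
    p.dualSmooth a = p.lam * (inner ℝ (p.dualMap a) (p.primalPoint a) - p.g (p.primalPoint a)) ∧
    (∀ b, p.dualSmooth a + ∑ l, 1 / (n : ℝ) * inner ℝ (p.A l) (p.primalPoint a) * (b l - a l) ≤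
      p.dualSmooth b) ∧
    ∀ b, p.dualSmooth b ≤
      p.dualSmooth a + ∑ l, 1 / (n : ℝ) * inner ℝ (p.A l) (p.primalPoint a) * (b l - a l)
        + coordLip n R p.lam / 2 * (∑ l, |b l - a l|) ^ 2 := by
  obtain ⟨h1, h2, h3⟩ := hg.fenchelConj_gradient (p.dualMap a)
  refine ⟨by rw [dualSmooth, h1]; rfl, fun b => ?_, fun b => ?_⟩
  · have := mul_le_mul_of_nonneg_left (h2 (p.dualMap b)) hlam.le
    rw [mul_add, inner_dualMap_sub hlam] at this
    exact this
  · have := mul_le_mul_of_nonneg_left (h3 (p.dualMap b)) hlam.le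
    rw [mul_add, mul_add, inner_dualMap_sub hlam] at this
    exact this.trans (add_le_add le_rfl (norm_dualMap_sub_le hlam hA a b))

theorem sq_sum_abs_le (v : EuclideanSpace ℝ (Fin n)) : (∑ l, |v l|) ^ 2 ≤ n * ‖v‖ ^ 2 := by
  have := sq_sum_le_card_mul_sum_sq (s := Finset.univ) (f := fun l => |v l|)
  simpa [EuclideanSpace.real_norm_sq_eq] using this

theorem coordLip_nonneg (hlam : 0 < p.lam) : 0 ≤ coordLip n R p.lam := by
  unfold coordLip
  positivity

theorem gradient_dualSmooth (hlam : 0 < p.lam) (hg : StrongConvexOn Set.univ 1 p.g)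
    (hA : ∀ l, ‖p.A l‖ ≤ R) (a : EuclideanSpace ℝ (Fin n)) (l : Fin n) :
    gradient p.dualSmooth a l = 1 / (n : ℝ) * inner ℝ (p.A l) (p.primalPoint a) := by
  obtain ⟨-, h2, h3⟩ := dualSmooth_bounds hlam hg hA a
  have hL := coordLip_nonneg (n := n) (R := R) hlam
  have hinner : ∀ b, inner ℝ (b - a)
      (WithLp.toLp 2 fun l => 1 / (n : ℝ) * inner ℝ (p.A l) (p.primalPoint a)) =
      ∑ l, 1 / (n : ℝ) * inner ℝ (p.A l) (p.primalPoint a) * (b l - a l) := fun b => by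
    simp [PiLp.inner_apply]
  have : HasGradientAt p.dualSmooth
      (WithLp.toLp 2 fun l => 1 / (n : ℝ) * inner ℝ (p.A l) (p.primalPoint a)) a := by
    refine hasGradientAt_of_quadratic_bounds (M := coordLip n R p.lam / 2 * n) (by positivity)
      (fun b => by rw [hinner]; exact h2 b) fun b => ?_
    rw [hinner]
    refine (h3 b).trans ?_
    have h4 := mul_le_mul_of_nonneg_left (sq_sum_abs_le (b - a)) (div_nonneg hL zero_le_two)
    simp only [PiLp.sub_apply] at h4
    linarith
  rw [this.gradient]

/-- The negated dual objective is a composite objective in the sense of `IsCoordComposite`. -/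
theorem isCoordComposite (hlam : 0 < p.lam) (hL₂ : 0 < L₂) (hs : ∀ l, IsLSmooth L₂ (p.φ l))
    (hb : ∀ l, BddBelow (Set.range (p.φ l))) (hg : StrongConvexOn Set.univ 1 p.g)
    (hA : ∀ l, ‖p.A l‖ ≤ R) :
    IsCoordComposite p.dualSmooth p.dualSep (coordLip n R p.lam) (strongMod n L₂) where
  convex a b := by
    simp only [gradient_dualSmooth hlam hg hA]
    exact (dualSmooth_bounds hlam hg hA a).2.1 b
  smooth a b := by
    simp only [gradient_dualSmooth hlam hg hA]
    exact (dualSmooth_bounds hlam hg hA a).2.2 b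
  ne_bot := dualSep_ne_bot
  strong l := strongConvexOn_dualSep hL₂ (hs l)
  zero_ne_top l := dualSep_zero_ne_top (hb l)

theorem dual_eq_coe {a : EuclideanSpace ℝ (Fin n)} (ha : a ∈ sepDom p.dualSep) :
    p.dual a = ((-(p.dualSmooth a + sepSum p.dualSep a) : ℝ) : EReal) := by
  rw [dual, ← EReal.sum_coe_toReal _ ha fun l => dualSep_ne_bot l _, ← EReal.coe_add,
    ← EReal.coe_neg, add_comm]
  rfl

theorem dual_eq_bot {a : EuclideanSpace ℝ (Fin n)} (ha : a ∉ sepDom p.dualSep) :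
    p.dual a = ⊥ := by
  simp only [sepDom, Set.mem_ofPred_eq, not_forall, not_not] at ha
  obtain ⟨l, hl⟩ := ha
  rw [dual, EReal.sum_eq_top_of_eq_top (fun l => dualSep_ne_bot l _) hl, EReal.top_add_coe,
    EReal.neg_top]

theorem weak_duality (hlam : 0 < p.lam) (hg : StrongConvexOn Set.univ 1 p.g)
    {a : EuclideanSpace ℝ (Fin n)} (ha : a ∈ sepDom p.dualSep) (x : EuclideanSpace ℝ (Fin d)) :
    -(p.dualSmooth a + sepSum p.dualSep a) ≤ p.primal x := by
  have h1 : p.lam * inner ℝ (p.dualMap a) x - p.lam * p.g x ≤ p.dualSmooth a := by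
    rw [← mul_sub]
    exact mul_le_mul_of_nonneg_left
      (inner_sub_le_toReal_fenchelConj (hg.fenchelConj_ne_top _) x) hlam.le
  have h2 : ∑ l, (-(1 / (n : ℝ) * inner ℝ (p.A l) x * a l)
      - 1 / (n : ℝ) * p.φ l (inner ℝ (p.A l) x)) ≤ sepSum p.dualSep a := by
    refine Finset.sum_le_sum fun l _ => ?_
    rw [toReal_dualSep]
    have h3 : fenchelConj (p.φ l) (-a l) ≠ ⊤ := (dualSep_eq_top_iff l _).not.1 (ha l)
    have h4 := mul_le_mul_of_nonneg_left
      (inner_sub_le_toReal_fenchelConj h3 (inner ℝ (p.A l) x)) (one_div_card_pos l).le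
    simp only [RCLike.inner_apply, conj_trivial] at h4
    linarith
  have h5 := inner_dualMap_sub hlam 0 a x
  have h6 : p.dualMap 0 = 0 := by simp [dualMap]
  simp only [h6, sub_zero, PiLp.zero_apply] at h5
  rw [Finset.sum_sub_distrib, Finset.sum_neg_distrib, ← h5, ← Finset.mul_sum] at h2
  unfold primal
  linarith

/-- A damped step towards the dual point built from the primal point closes a fraction
`1 / (1 + R² L₂ / lam)` of the duality gap. -/
theorem exists_gap_le (hlam : 0 < p.lam) (hL₂ : 0 < L₂) (hn : 0 < n)
    (hφ : ∀ l, ConvexOn ℝ Set.univ (p.φ l)) (hs : ∀ l, IsLSmooth L₂ (p.φ l))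
    (hg : StrongConvexOn Set.univ 1 p.g)
    (hA : ∀ l, ‖p.A l‖ ≤ R) {a : EuclideanSpace ℝ (Fin n)} (ha : a ∈ sepDom p.dualSep) :
    ∃ b ∈ sepDom p.dualSep, p.primal (p.primalPoint a) + (p.dualSmooth a + sepSum p.dualSep a) ≤
      (1 + R ^ 2 * L₂ / p.lam) * (p.dualSmooth a + sepSum p.dualSep a
        - (p.dualSmooth b + sepSum p.dualSep b)) := by
  set κ := R ^ 2 * L₂ / p.lam with hκ
  have hκ0 : 0 ≤ κ := by positivity
  have hn0 : (0 : ℝ) < n := by exact_mod_cast hn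
  -- This step length solves `1 - s = s * κ`, where the quadratic loss of the smooth part, with the
  -- factor `n` from comparing ℓ¹ and ℓ², equals the strong convexity gain of the separable part.
  set s := (1 + κ)⁻¹ with hsdef
  have hs0 : 0 < s := by positivity
  have hs1 : s ≤ 1 := inv_le_one_of_one_le₀ (by linarith)
  have hsκ : s * (1 + κ) = 1 := inv_mul_cancel₀ (by positivity)
  set t : Fin n → ℝ := fun l => inner ℝ (p.A l) (p.primalPoint a) with ht
  -- At this point Fenchel–Young is an equality in every loss, evaluated at the primal point of `a`.
  set u : EuclideanSpace ℝ (Fin n) := WithLp.toLp 2 fun l => -deriv (p.φ l) (t l) with hu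
  have hconj : ∀ l, fenchelConj (p.φ l) (-u l) =
      ((deriv (p.φ l) (t l) * t l - p.φ l (t l) : ℝ) : EReal) := fun l => by
    simp only [hu, neg_neg]
    exact (hφ l).fenchelConj_deriv ((hs l).1 (t l))
  have hudom : u ∈ sepDom p.dualSep := fun l => by
    rw [Ne, dualSep_eq_top_iff, hconj]
    exact EReal.coe_ne_top _
  have husum : sepSum p.dualSep u =
      -∑ l, 1 / (n : ℝ) * t l * u l - 1 / (n : ℝ) * ∑ l, p.φ l (t l) := by
    rw [sepSum, Finset.mul_sum, ← Finset.sum_neg_distrib, ← Finset.sum_sub_distrib]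
    refine Finset.sum_congr rfl fun l _ => ?_
    rw [toReal_dualSep, hconj, EReal.toReal_coe]
    simp only [hu]
    ring
  have hstrong := strongConvexOn_sepSum fun l => strongConvexOn_dualSep hL₂ (hs l)
  have hbdom := hstrong.1 hudom ha hs0.le (sub_nonneg.2 hs1) (by ring)
  have hbsum := hstrong.2 hudom ha hs0.le (sub_nonneg.2 hs1) (by ring)
  obtain ⟨h1, -, h3⟩ := dualSmooth_bounds hlam hg hA a
  refine ⟨_, hbdom, ?_⟩
  set b := s • u + (1 - s) • a with hb
  have hbl : ∀ l, b l - a l = s * (u l - a l) := fun l => by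
    simp only [hb, PiLp.add_apply, PiLp.smul_apply, smul_eq_mul]
    ring
  have h4 := h3 b
  simp only [hbl, abs_mul, abs_of_pos hs0] at h4
  rw [← Finset.mul_sum, mul_pow] at h4
  have h5 : ∑ l, 1 / (n : ℝ) * inner ℝ (p.A l) (p.primalPoint a) * (s * (u l - a l)) =
      s * (∑ l, 1 / (n : ℝ) * t l * u l - ∑ l, 1 / (n : ℝ) * t l * a l) := by
    rw [← Finset.sum_sub_distrib, Finset.mul_sum]
    refine Finset.sum_congr rfl fun l _ => ?_
    simp only [ht]
    ring
  rw [h5] at h4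
  have h6 : coordLip n R p.lam / 2 * (s ^ 2 * (∑ l, |u l - a l|) ^ 2) ≤
      s * (1 - s) * (strongMod n L₂ / 2 * ‖u - a‖ ^ 2) := by
    have h7 := sq_sum_abs_le (u - a)
    simp only [PiLp.sub_apply] at h7
    have h8 : 0 ≤ coordLip n R p.lam := coordLip_nonneg hlam
    have h9 : coordLip n R p.lam / 2 * s ^ 2 * n = s * (1 - s) * (strongMod n L₂ / 2) := by
      have h10 : 1 - s = s * κ := by linarith
      rw [h10, hκ, coordLip, strongMod]
      field_simp
    calc coordLip n R p.lam / 2 * (s ^ 2 * (∑ l, |u l - a l|) ^ 2)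
        ≤ coordLip n R p.lam / 2 * (s ^ 2 * (n * ‖u - a‖ ^ 2)) := by gcongr
      _ = coordLip n R p.lam / 2 * s ^ 2 * n * ‖u - a‖ ^ 2 := by ring
      _ = _ := by rw [h9]; ring
  have h11 := inner_dualMap_sub hlam 0 a (p.primalPoint a)
  have h12 : p.dualMap 0 = 0 := by simp [dualMap]
  simp only [h12, sub_zero, PiLp.zero_apply] at h11
  -- The duality gap is the first-order decrease of the negated dual from `a` towards `u`, with the
  -- separable part kept exact.
  have h13 : p.primal (p.primalPoint a) + (p.dualSmooth a + sepSum p.dualSep a) =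
      sepSum p.dualSep a - sepSum p.dualSep u
        - (∑ l, 1 / (n : ℝ) * t l * u l - ∑ l, 1 / (n : ℝ) * t l * a l) := by
    rw [husum, h1, primal, mul_sub, h11]
    ring
  simp only [smul_eq_mul] at hbsum
  have h14 : s * (p.primal (p.primalPoint a) + (p.dualSmooth a + sepSum p.dualSep a)) ≤
      p.dualSmooth a + sepSum p.dualSep a - (p.dualSmooth b + sepSum p.dualSep b) := by
    rw [h13]
    linarith
  have h15 := mul_le_mul_of_nonneg_left h14 (by positivity : 0 ≤ 1 + κ)
  rwa [← mul_assoc, mul_comm (1 + κ) s, hsκ, one_mul] at h15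

end ERM

/-! ### Step size, momentum and iteration count -/

/-- The defining equation of the momentum parameter and the resulting bounds. -/
theorem momentum_spec {n : ℕ} {γ μ : ℝ} (hn : 0 < n) (hγμ : 0 < γ * μ) (hle : γ * μ ≤ 1 / 64) :
    0 < momentum n γ μ ∧ n * momentum n γ μ ≤ 1 / 8 ∧
      (n * momentum n γ μ) ^ 2 + n * momentum n γ μ * (γ * μ) = γ * μ ∧
      γ * μ / 4 ≤ (n * momentum n γ μ) ^ 2 := by
  have hn0 : (0 : ℝ) < n := by exact_mod_cast hn
  set g := γ * μ with hg
  have hr := Real.sq_sqrt (by positivity : 0 ≤ g ^ 2 + 4 * g)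
  have hlt : g < Real.sqrt (g ^ 2 + 4 * g) := Real.lt_sqrt_of_sq_lt (by linarith)
  set r := Real.sqrt (g ^ 2 + 4 * g)
  have hq : n * momentum n γ μ = (-g + r) / 2 := by
    rw [momentum, ← hg, mul_comm 2 (n : ℝ), mul_div_assoc', mul_div_mul_left _ _ hn0.ne']
  have heq : (n * momentum n γ μ) ^ 2 + n * momentum n γ μ * g = g := by
    rw [hq]
    linarith
  have hpos : 0 < n * momentum n γ μ := by
    rw [hq]
    linarith
  have hle8 : n * momentum n γ μ ≤ 1 / 8 := by
    rw [← pow_le_pow_iff_left₀ hpos.le (by norm_num) two_ne_zero]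
    have : 0 < n * momentum n γ μ * g := by positivity
    linarith
  refine ⟨pos_of_mul_pos_right hpos hn0.le, hle8, heq, ?_⟩
  have := mul_le_mul_of_nonneg_right hle8 hγμ.le
  linarith

/-- A linear rate `1 - θ` reaches accuracy `ε` from `M` once `K ≥ θ⁻¹ log (M / ε)`. -/
theorem pow_mul_le_of_log_le {θ X M ε : ℝ} {K : ℕ} (hθ0 : 0 ≤ θ) (hθ1 : θ ≤ 1) (hX : 1 ≤ θ * X)
    (hM : 0 ≤ M) (hε : 0 < ε) (hK : X * Real.log (M / ε) ≤ K) : (1 - θ) ^ K * M ≤ ε := by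
  rcases hM.eq_or_lt with rfl | hM
  · simpa using hε.le
  have h0 : 0 ≤ (1 - θ) ^ K := pow_nonneg (by linarith) K
  -- For `M ≤ ε` the logarithm is not positive and gives no lower bound on `K`, but the initial
  -- value is already small enough.
  rcases le_total M ε with h | h
  · have := pow_le_one₀ (n := K) (sub_nonneg.2 hθ1) (by linarith)
    calc (1 - θ) ^ K * M ≤ 1 * M := by gcongr
      _ ≤ ε := by linarith
  · have hlog : 0 ≤ Real.log (M / ε) := Real.log_nonneg ((one_le_div hε).2 h)
    have h1 : Real.log (M / ε) ≤ K * θ := by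
      calc Real.log (M / ε) = 1 * Real.log (M / ε) := (one_mul _).symm
        _ ≤ θ * X * Real.log (M / ε) := by gcongr
        _ = θ * (X * Real.log (M / ε)) := by ring
        _ ≤ θ * K := by gcongr
        _ = K * θ := mul_comm _ _
    have h2 : (1 - θ) ^ K ≤ Real.exp (-(K * θ)) := by
      calc (1 - θ) ^ K ≤ Real.exp (-θ) ^ K :=
            pow_le_pow_left₀ (by linarith) (Real.one_sub_le_exp_neg θ) K
        _ = Real.exp (-(K * θ)) := by rw [← Real.exp_nat_mul]; ring_nf
    have h3 : Real.exp (-(K * θ)) ≤ ε / M := by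
      rw [← inv_div M ε, Real.exp_neg]
      apply inv_anti₀ (by positivity)
      rwa [← Real.log_le_iff_le_exp (by positivity)]
    rw [← le_div_iff₀ hM]
    exact h2.trans h3

/-- Besides positivity of `R ^ 2`, this gives `R² L₂ / lam ≥ 1`, which lets the cube in the
logarithm absorb numerical factors. -/
theorem condition_ge_card {n : ℕ} {lam L₂ R : ℝ} (hn : 0 < n) (hlam : 0 < lam) (hL₂ : 0 < L₂)
    (hμL : strongMod n L₂ ≤ coordLip n R lam) : (n : ℝ) ≤ R ^ 2 * L₂ / lam := by
  have hn0 : (0 : ℝ) < n := by exact_mod_cast hn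
  have h1 := mul_le_mul_of_nonneg_right hμL (by positivity : 0 ≤ n ^ 2 * L₂)
  rw [strongMod, coordLip] at h1
  have h2 : 1 / (n * L₂) * (n ^ 2 * L₂) = n := by field_simp
  have h3 : R ^ 2 / (lam * n ^ 2) * (n ^ 2 * L₂) = R ^ 2 * L₂ / lam := by field_simp
  rwa [h2, h3] at h1

/-- The step size and the momentum parameter satisfy the requirements of the rate. -/
theorem stepSize_spec {n τ : ℕ} {lam L₂ R : ℝ} (hn : 0 < n) (hτ : 1 ≤ τ) (hlam : 0 < lam)
    (hL₂ : 0 < L₂) (hμL : strongMod n L₂ ≤ coordLip n R lam) {γ θ : ℝ}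
    (hγ : γ = stepSize (1 / 64) n τ R lam) (hθ : θ = momentum n γ (strongMod n L₂)) :
    0 < γ ∧ 0 < θ ∧ n * θ ≤ 1 / 8 ∧
      (n * θ) ^ 2 / γ + n * θ * strongMod n L₂ = strongMod n L₂ ∧
      8 * coordLip n R lam * (τ + 1) ^ 2 * γ ≤ 1 ∧
      1 ≤ θ * (16 * (τ * Real.sqrt (n * R ^ 2 * L₂ / lam))) := by
  have hn0 : (0 : ℝ) < n := by exact_mod_cast hn
  have hτ1 : (1 : ℝ) ≤ τ := by exact_mod_cast hτ
  have hκ := condition_ge_card hn hlam hL₂ hμL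
  have hμ : 0 < strongMod n L₂ := by unfold strongMod; positivity
  have hL : 0 < coordLip n R lam := hμ.trans_le hμL
  have hγ0 : 0 < γ := by rw [hγ, stepSize]; positivity
  have hγL : coordLip n R lam * τ ^ 2 * γ = 1 / 64 := by
    rw [hγ, stepSize]
    field_simp
  -- From `μ ≤ L_c` and `1 ≤ τ`; this keeps `n * θ` at most `1 / 8`.
  have hγμ : γ * strongMod n L₂ ≤ 1 / 64 := by
    calc γ * strongMod n L₂ ≤ γ * (coordLip n R lam * τ ^ 2) := by
          gcongr
          exact hμL.trans (le_mul_of_one_le_right hL.le (one_le_pow₀ hτ1))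
      _ = 1 / 64 := by rw [mul_comm, hγL]
  obtain ⟨h1, h2, h3, h4⟩ := momentum_spec hn (by positivity) hγμ
  rw [← hθ] at h1 h2 h3 h4
  refine ⟨hγ0, h1, h2, ?_, ?_, ?_⟩
  · field_simp
    linarith
  · calc 8 * coordLip n R lam * (τ + 1) ^ 2 * γ ≤ 8 * coordLip n R lam * (2 * τ) ^ 2 * γ := by
          gcongr
          linarith
      _ = 32 * (coordLip n R lam * τ ^ 2 * γ) := by ring
      _ ≤ 1 := by rw [hγL]; norm_num
  · rw [← pow_le_pow_iff_left₀ zero_le_one (by positivity) two_ne_zero]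
    have hR : 0 < R ^ 2 := by
      have : 0 < R ^ 2 * L₂ / lam := hn0.trans_le hκ
      by_contra hR
      rw [le_antisymm (not_lt.1 hR) (sq_nonneg R)] at this
      simp at this
    have h5 : γ * strongMod n L₂ = 1 / 64 * (lam * n / (R ^ 2 * τ ^ 2 * L₂)) := by
      rw [hγ, stepSize, coordLip, strongMod]
      field_simp
    have hR0 : R ≠ 0 := fun h => by simp [h] at hR
    rw [mul_pow, mul_pow, mul_pow, Real.sq_sqrt (by positivity)]
    have h7 : θ ^ 2 * (16 ^ 2 * (τ ^ 2 * (n * R ^ 2 * L₂ / lam))) =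
        (n * θ) ^ 2 * (256 * (τ ^ 2 * R ^ 2 * L₂ / (lam * n))) := by
      field_simp
      ring
    rw [h7]
    -- Origin of the constant `16`: `16² = 256 = 4 * 64`, with `4` from `(n θ)² ≥ γ μ / 4` and `64`
    -- from the step size.
    calc (1 : ℝ) ^ 2 = γ * strongMod n L₂ / 4 * (256 * (τ ^ 2 * R ^ 2 * L₂ / (lam * n))) := by
          rw [h5]
          field_simp
          norm_num
      _ ≤ _ := by gcongr

/-! ### Finiteness of the dual optimum and the primal gap -/

namespace ERM

variable {n d : ℕ} {p : ERM n d} {L₂ R : ℝ}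

/-- The optimal dual value is finite, and is approached on the domain of the dual. -/
theorem exists_dualOpt_eq (hlam : 0 < p.lam) (hb : ∀ l, BddBelow (Set.range (p.φ l)))
    (hg : StrongConvexOn Set.univ 1 p.g) :
    ∃ m : ℝ, p.dualOpt = ((-m : ℝ) : EReal) ∧
      (∀ a ∈ sepDom p.dualSep, m ≤ p.dualSmooth a + sepSum p.dualSep a) ∧
      ∀ η > 0, ∃ a ∈ sepDom p.dualSep, p.dualSmooth a + sepSum p.dualSep a ≤ m + η := by
  have h0 : (0 : EuclideanSpace ℝ (Fin n)) ∈ sepDom p.dualSep :=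
    fun l => dualSep_zero_ne_top (hb l)
  have hle : ∀ a, p.dual a ≤ p.dualOpt := fun a => le_iSup p.dual a
  have htop : p.dualOpt ≠ ⊤ := by
    refine ne_top_of_le_ne_top (EReal.coe_ne_top (p.primal 0)) (iSup_le fun a => ?_)
    by_cases ha : a ∈ sepDom p.dualSep
    · rw [dual_eq_coe ha, EReal.coe_le_coe_iff]
      exact weak_duality hlam hg ha 0
    · rw [dual_eq_bot ha]
      exact bot_le
  have hbot : p.dualOpt ≠ ⊥ := by
    refine ne_bot_of_le_ne_bot ?_ (hle 0)
    rw [dual_eq_coe h0]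
    exact EReal.coe_ne_bot _
  have hm : p.dualOpt = ((- -p.dualOpt.toReal : ℝ) : EReal) := by
    rw [neg_neg, EReal.coe_toReal htop hbot]
  refine ⟨-p.dualOpt.toReal, hm, fun a ha => ?_, fun η hη => ?_⟩
  · have := hle a
    rw [dual_eq_coe ha, hm, EReal.coe_le_coe_iff] at this
    linarith
  · have hlt : ((p.dualOpt.toReal - η : ℝ) : EReal) < p.dualOpt := by
      conv_rhs => rw [hm]
      rw [EReal.coe_lt_coe_iff]
      linarith
    obtain ⟨a, ha⟩ := lt_iSup_iff.1 hlt
    by_cases had : a ∈ sepDom p.dualSep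
    · rw [dual_eq_coe had, EReal.coe_lt_coe_iff] at ha
      exact ⟨a, had, by linarith⟩
    · rw [dual_eq_bot had] at ha
      exact absurd ha not_lt_bot

/-- The primal gap at the primal point of `a` is at most `1 + R² L₂ / lam` dual gaps. -/
theorem primal_gap_le (hlam : 0 < p.lam) (hL₂ : 0 < L₂) (hn : 0 < n)
    (hφ : ∀ l, ConvexOn ℝ Set.univ (p.φ l)) (hs : ∀ l, IsLSmooth L₂ (p.φ l))
    (hg : StrongConvexOn Set.univ 1 p.g) (hA : ∀ l, ‖p.A l‖ ≤ R) {m : ℝ}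
    (hm : ∀ a ∈ sepDom p.dualSep, m ≤ p.dualSmooth a + sepSum p.dualSep a)
    {a : EuclideanSpace ℝ (Fin n)} (ha : a ∈ sepDom p.dualSep) :
    p.primal (p.primalPoint a) - p.primalOpt ≤
      (1 + R ^ 2 * L₂ / p.lam) * (p.dualSmooth a + sepSum p.dualSep a - m) := by
  obtain ⟨b, hb, hgap⟩ := exists_gap_le hlam hL₂ hn hφ hs hg hA ha
  have h1 : -(p.dualSmooth a + sepSum p.dualSep a) ≤ p.primalOpt :=
    le_ciInf fun x => weak_duality hlam hg ha x
  have h2 := hm b hb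
  have h3 : (1 + R ^ 2 * L₂ / p.lam) * (p.dualSmooth a + sepSum p.dualSep a
      - (p.dualSmooth b + sepSum p.dualSep b)) ≤
      (1 + R ^ 2 * L₂ / p.lam) * (p.dualSmooth a + sepSum p.dualSep a - m) := by
    gcongr
  linarith

end ERM

end

/-! ### The main theorem -/

theorem theorem4 :
    ∃ c : ℝ, 0 < c ∧ ∃ C : ℝ, 0 < C ∧
      ∀ (n d : ℕ) (p : ERM n d) (L₂ R : ℝ) (τ : ℕ),
        0 < p.lam → 0 < L₂ →
        (∀ i, ConvexOn ℝ Set.univ (p.φ i)) →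
        (∀ i, IsLSmooth L₂ (p.φ i)) →
        (∀ i, BddBelow (Set.range (p.φ i))) →
        StrongConvexOn Set.univ 1 p.g →
        (∀ i, ‖p.A i‖ ≤ R) →
        1 ≤ τ → (τ : ℝ) ≤ Real.sqrt n →
        strongMod n L₂ ≤ coordLip n R p.lam →
        ∀ (Ω : Type*) [mΩ : MeasurableSpace Ω] (P : Measure Ω) [IsProbabilityMeasure P]
          (ℱ : Filtration ℕ mΩ) (i : ℕ → Ω → Fin n) (j : ℕ → Ω → ℕ)
          (α y z w : ℕ → Ω → EuclideanSpace ℝ (Fin n)),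
          IsSchedule P ℱ τ i j →
          (∀ ω, IsAASCDRun p.dualSmooth p.dualSep
            (stepSize c n τ R p.lam)
            (momentum n (stepSize c n τ R p.lam) (strongMod n L₂))
            (fun k => i k ω) (fun k => j k ω)
            (fun k => α k ω) (fun k => y k ω) (fun k => z k ω) (fun k => w k ω)) →
          ∀ (ε : ℝ) (K : ℕ), 0 < ε →
            C * ((n : ℝ) + (τ : ℝ) * Real.sqrt ((n : ℝ) * R ^ 2 * L₂ / p.lam) *
              Real.log ((1 + R ^ 2 * L₂ / p.lam) ^ 3 * (p.dualOpt - p.dual 0).toReal / ε))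
                ≤ (oracleCalls n K : ℝ) →
            ∫⁻ ω, (p.dualOpt - p.dual (α K ω)).toENNReal ∂P ≤ ENNReal.ofReal ε ∧
            ∫⁻ ω, ENNReal.ofReal (p.primal (p.primalPoint (α K ω)) - p.primalOpt) ∂P
              ≤ ENNReal.ofReal ε := by
  refine ⟨1 / 64, by norm_num, 16, by norm_num, ?_⟩
  intro n d p L₂ R τ hlam hL₂ hφ hs hb hg hA hτ hτn hμL Ω mΩ P _ ℱ i j α y z w hS hr ε K hε hK
  -- A probability space is nonempty, so some coordinate is chosen and `Fin n` is inhabited.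
  have hn : 0 < n := by
    obtain ⟨ω⟩ := nonempty_of_isProbabilityMeasure P
    exact (i 0 ω).pos
  have hn1 : (1 : ℝ) ≤ n := by exact_mod_cast hn
  have hτn' : τ ≤ n := by
    have : (τ : ℝ) ≤ n := hτn.trans (Real.sqrt_le_left (by positivity) |>.2 (by nlinarith))
    exact_mod_cast this
  obtain ⟨hγ, hθ0, hnθ, hθγ, hstep, hX⟩ := stepSize_spec hn hτ hlam hL₂ hμL rfl rfl
  set γ := stepSize (1 / 64) n τ R p.lam
  set θ := momentum n γ (strongMod n L₂)
  have hμ : 0 ≤ strongMod n L₂ := by unfold strongMod; positivity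
  have hκ := condition_ge_card hn hlam hL₂ hμL
  set κ := R ^ 2 * L₂ / p.lam
  have hc := ERM.isCoordComposite hlam hL₂ hs hb hg hA
  have hθ1 : θ ≤ 1 := by nlinarith
  obtain ⟨m, hopt, hm, hm'⟩ := ERM.exists_dualOpt_eq hlam hb hg
  have hdom : ∀ ω, α K ω ∈ sepDom p.dualSep := fun ω =>
    ((hr ω).x_mem_sepDom hc hμ hθ0.le hθ1 (by linarith) K).1
  have h0 : (0 : EuclideanSpace ℝ (Fin n)) ∈ sepDom p.dualSep := hc.zero_ne_top
  have hgap : ∀ a ∈ sepDom p.dualSep, p.dualOpt - p.dual a =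
      ((p.dualSmooth a + sepSum p.dualSep a - m : ℝ) : EReal) := fun a ha => by
    rw [hopt, ERM.dual_eq_coe ha, ← EReal.coe_sub]
    congr 1
    ring
  set F : EuclideanSpace ℝ (Fin n) → ℝ := fun a => p.dualSmooth a + sepSum p.dualSep a with hF
  set Δ := F 0 - m with hΔ
  have hΔ0 : 0 ≤ Δ := sub_nonneg.2 (hm 0 h0)
  rw [hgap 0 h0, EReal.toReal_coe] at hK
  have hpow : (1 - θ) ^ K * ((1 + κ) ^ 3 * Δ) ≤ ε := by
    refine pow_mul_le_of_log_le hθ0.le hθ1 hX (by positivity) hε ?_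
    simp only [oracleCalls] at hK
    push_cast at hK
    linarith
  have hconv := integral_objective_sub_inf_le hS hr hc hμ (ERM.coordLip_nonneg hlam) hγ hn hθ0
    (by linarith) hθγ hτn' hstep hm hm' K
  have hκ_int : 0 < n * θ / (2 * γ) := by positivity
  have hint : Integrable (fun ω => F (α K ω) - m) P :=
    integrable_iterate hS hr hc hμ hκ_int (fun a => F a - m) K
  have hE : ∫ ω, (F (α K ω) - m) ∂P = ∫ ω, F (α K ω) ∂P - m := by
    rw [integral_sub (integrable_iterate hS hr hc hμ hκ_int F K) (integrable_const _)]
    simp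
  have hρ0 : 0 ≤ (1 - θ) ^ K := pow_nonneg (by linarith) K
  have hκ1 : 1 ≤ κ := hn1.trans hκ
  -- One factor `1 + κ` converts the dual gap to the primal gap; the other two dominate the `3` of
  -- the rate, because `κ ≥ 1`. This single bound covers both conclusions.
  have hfinal : (1 + κ) * ∫ ω, (F (α K ω) - m) ∂P ≤ ε := by
    rw [hE]
    calc (1 + κ) * (∫ ω, F (α K ω) ∂P - m) ≤ (1 + κ) * (3 * ((1 - θ) ^ K * Δ)) := by gcongr
      _ = (1 - θ) ^ K * ((1 + κ) * 3 * Δ) := by ring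
      _ ≤ (1 - θ) ^ K * ((1 + κ) ^ 3 * Δ) := by
        rw [pow_succ' (1 + κ) 2]
        gcongr
        nlinarith
      _ ≤ ε := hpow
  have hnonneg : ∀ ω, 0 ≤ F (α K ω) - m := fun ω => sub_nonneg.2 (hm _ (hdom ω))
  have hlint : ∫⁻ ω, ENNReal.ofReal ((1 + κ) * (F (α K ω) - m)) ∂P ≤ ENNReal.ofReal ε := by
    rw [← ofReal_integral_eq_lintegral_ofReal (hint.const_mul _)
      (ae_of_all _ fun ω => mul_nonneg (by positivity) (hnonneg ω)), integral_const_mul]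
    exact ENNReal.ofReal_le_ofReal hfinal
  constructor
  · refine le_trans (lintegral_mono fun ω => ?_) hlint
    rw [hgap _ (hdom ω), EReal.real_coe_toENNReal]
    exact ENNReal.ofReal_le_ofReal (le_mul_of_one_le_left (hnonneg ω) (by linarith))
  · refine le_trans (lintegral_mono fun ω => ?_) hlint
    exact ENNReal.ofReal_le_ofReal
      (ERM.primal_gap_le hlam hL₂ hn hφ hs hg hA hm (hdom ω))
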